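/- Let $(W,S)$ be a Coxeter system, with Coxeter matrix entries $m(r,r')$, which is doubly laced: $m(r,r')\le 4$ for all $r,r'\in S$. Let $\le$ be the Bruhat order, $e$ the identity, and $D_L(w)$, $D_R(w)$ the sets of left and right descents of $w$. For $J\subseteq S$ let $W_J$ be the subgroup generated by $J$. Write $w=w^J\cdot w_J$ for the unique factorization with $w_J\in W_J$ and $D_R(w^J)\cap J=\emptyset$, and $w={}_Jw\cdot{}^Jw$ for the unique factorization with ${}_Jw\in W_J$ and $D_L({}^Jw)\cap J=\emptyset$. Let $w_0(s,t)$ be the maximum of $W_{\{s,t\}}\cap[e,w]$. A *special matching* of $w$ is an involution $M$ of $[e,w]$ such that, for every $u\le w$, one of $u$, $M(u)$ covers the other, and such that $M(u)\le M(v)$ whenever $v$ covers $u$ and $M(u)\ne v$. A *left* (respectively *right*) *multiplication matching* of $w$ is a map $\lambda_l(u)=lu$ with $l\in D_L(w)$ (respectively $\rho_r(u)=ur$ with $r\in D_R(w)$) on $[e,w]$. Maps $M,N$ commute on a set $A$ if $M(N(u))=N(M(u))$ for all $u\in A$. A *right system* for $w$ is a quadruple $(J,s,t,M_{st})$ such that: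 1. $J\subseteq S$, $s\in J$, $t\in S\setminus J$, and $M_{st}$ is a special matching of $w_0(s,t)$ with $M_{st}(e)=s$ and (if $t\le w$) $M_{st}(t)=ts$; 2. $\mathcal R(u):=(u^J)^{\{s,t\}}\cdot M_{st}\big((u^J)_{\{s,t\}}\cdot{}_{\{s\}}(u_J)\big)\cdot{}^{\{s\}}(u_J)\le w$ for all $u\le w$; 3. if $r\in J$ and $r\le w^J$, then $rs=sr$; 4. with $x=(w^J)^{\{s,t\}}$: if $s\le x$ and $t\le x$, then $M_{st}=\rho_s$ on $[e,w_0(s,t)]$; if $s\le x$ and $t\not\le x$, then $M_{st}$ commutes with $\lambda_s$ on $[e,w_0(s,t)]$; if $s\not\le x$ and $t\le x$, then $M_{st}$ commutes with $\lambda_t$ on $[e,w_0(s,t)]$; 5. if $v\le w$ and $s\le{}^{\{s\}}(v_J)$, then $M_{st}$ commutes with $\rho_s$ on $[e,v]\cap[e,w_0(s,t)]$. A matching $M$ of $w$ is *associated* with the right system if $M(u)=\mathcal R(u)$ for all $u\le w$. *Left systems* and the matchings associated with them are the mirror images (under $u\mapsto u^{-1}$): a left system for $w$ is a quadruple $(J,s,t,M_{st})$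 such that: 1. $J\subseteq S$, $s\in J$, $t\in S\setminus J$, and $M_{st}$ is a special matching of $w_0(s,t)$ with $M_{st}(e)=s$ and (if $t\le w$) $M_{st}(t)=st$; 2. $\mathcal L(u):=({}_Ju)^{\{s\}}\cdot M_{st}\big(({}_Ju)_{\{s\}}\cdot{}_{\{s,t\}}({}^Ju)\big)\cdot{}^{\{s,t\}}({}^Ju)\le w$ for all $u\le w$; 3. if $r\in J$ and $r\le{}^Jw$, then $rs=sr$; 4. with $x={}^{\{s,t\}}({}^Jw)$: if $s\le x$ and $t\le x$, then $M_{st}=\lambda_s$ on $[e,w_0(s,t)]$; if $s\le x$ and $t\not\le x$, then $M_{st}$ commutes with $\rho_s$ on $[e,w_0(s,t)]$; if $s\not\le x$ and $t\le x$, then $M_{st}$ commutes with $\rho_t$ on $[e,w_0(s,t)]$; 5. if $v\le w$ and $s\le({}_Jv)^{\{s\}}$, then $M_{st}$ commutes with $\lambda_s$ on $[e,v]\cap[e,w_0(s,t)]$. A matching $M$ of $w$ is associated with the left system if $M(u)=\mathcal L(u)$ for all $u\le w$. **Proposition.** Let $w\in W$ and let $M$ be a special matching of $w$. **(A)** If $M$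 is associated with a right system $(J,s,t,M_{st})$ for $w$ and $M$ is not a left multiplication matching, then there is a left multiplication matching $\lambda$ of $w$ commuting with $M$ on $[e,w]$ and such that $\lambda(w)\ne M(w)$, unless $m(s,t)=4$ and one of the following cases holds: - *First case:* $w_0(s,t)=tst$, $(w^J)^{\{s,t\}}=e$, and $w=tst\cdot{}^{\{s\}}(w_J)$. - *Second case:* $w_0(s,t)=tsts=stst$; $(w^J)^{\{s,t\}}=e$; either $w=tsts\cdot{}^{\{s\}}(w_J)$, or $w=tst\cdot{}^{\{s\}}(w_J)$ with $s\le{}^{\{s\}}(w_J)$; and $M(tsts)=sts$ (and then $M_{st}$ maps $e\mapsto s$, $t\mapsto ts$, $st\mapsto tst$, $sts\mapsto tsts$). **(B)** If $M$ is associated with a left system $(J,s,t,M_{st})$ for $w$ and $M$ is not a right multiplication matching, then there is a right multiplication matching $\rho$ of $w$ commuting with $M$ on $[e,w]$ and such that $\rho(w)\ne M(w)$, unless $m(s,t)=4$ and one of the following cases holds: - *First case:* $w_0(s,t)=tst$, ${}^{\{s,t\}}({}^Jw)=e$, and $w=({}_Jw)^{\{s\}}\cdot tst$. - *Second case:* $w_0(s,t)=stst=tsts$;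 ${}^{\{s,t\}}({}^Jw)=e$; either $w=({}_Jw)^{\{s\}}\cdot stst$, or $w=({}_Jw)^{\{s\}}\cdot tst$ with $s\le({}_Jw)^{\{s\}}$; and $M(stst)=sts$ (and then $M_{st}$ maps $e\mapsto s$, $t\mapsto st$, $ts\mapsto tst$, $sts\mapsto stst$). -/

import Mathlib

namespace CoxeterSystem

variable {B W : Type*} [Group W] {C : CoxeterMatrix B} (cs : CoxeterSystem C W)

/-! ### Bruhat order -/

/-- An edge `u → v` of the Bruhat graph: `u⁻¹ v` is a reflection and `ℓ(u) < ℓ(v)`. -/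
def BruhatEdge (u v : W) : Prop :=
  cs.IsReflection (u⁻¹ * v) ∧ cs.length u < cs.length v

/-- The Bruhat order: the reflexive transitive closure of the Bruhat graph. -/
def BruhatLE (u v : W) : Prop :=
  Relation.ReflTransGen cs.BruhatEdge u v

/-- `u ⋖ v` in the Bruhat order. -/
def BruhatCovBy (u v : W) : Prop :=
  cs.BruhatLE u v ∧ u ≠ v ∧ ∀ z, cs.BruhatLE u z → cs.BruhatLE z v → z = u ∨ z = v

/-! ### Parabolic subgroups and factorizations -/

/-- The parabolic subgroup `W_J`. -/
def parabolic (J : Set B) : Subgroup W :=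
  Subgroup.closure (cs.simple '' J)

/-- The set `W^J` of minimal coset representatives. -/
def minCosetReps (J : Set B) : Set W :=
  {x | ∀ j ∈ J, ¬ cs.IsRightDescent x j}

theorem exists_minCosetRep (J : Set B) (w : W) :
    ∃ x, x ∈ cs.minCosetReps J ∧ x⁻¹ * w ∈ cs.parabolic J := by
  have hne : {x : W | x⁻¹ * w ∈ cs.parabolic J}.Nonempty :=
    ⟨w, by simp only [Set.mem_ofPred_eq, inv_mul_cancel]; exact one_mem _⟩
  obtain ⟨x, hx, hmin⟩ := exists_minimalFor_of_wellFoundedLT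
    (fun x : W => x⁻¹ * w ∈ cs.parabolic J) cs.length hne
  refine ⟨x, fun j hj hd => ?_, hx⟩
  have hmem : (x * cs.simple j)⁻¹ * w ∈ cs.parabolic J := by
    have h : (x * cs.simple j)⁻¹ * w = cs.simple j * (x⁻¹ * w) := by
      simp [mul_assoc]
    rw [h]
    exact mul_mem (Subgroup.subset_closure ⟨j, hj, rfl⟩) hx
  have h1 := hmin hmem (le_of_lt hd)
  exact absurd hd (not_lt.mpr h1)

/-- The factor `w^J ∈ W^J` of the factorization `w = w^J · w_J`. -/
noncomputable def minRep (J : Set B) (w : W) : W :=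
  Classical.choose (cs.exists_minCosetRep J w)

/-- The factor `w_J ∈ W_J` of the factorization `w = w^J · w_J`. -/
noncomputable def parPart (J : Set B) (w : W) : W :=
  (cs.minRep J w)⁻¹ * w

theorem minRep_mem (J : Set B) (w : W) : cs.minRep J w ∈ cs.minCosetReps J :=
  (Classical.choose_spec (cs.exists_minCosetRep J w)).1

theorem parPart_mem (J : Set B) (w : W) : cs.parPart J w ∈ cs.parabolic J :=
  (Classical.choose_spec (cs.exists_minCosetRep J w)).2

theorem minRep_mul_parPart (J : Set B) (w : W) : cs.minRep J w * cs.parPart J w = w := by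
  simp [parPart]

/-- The factor `ᴶw ∈ ᴶW = (W^J)⁻¹` of the left factorization `w = _Jw · ᴶw`. -/
noncomputable def leftMinRep (J : Set B) (w : W) : W :=
  (cs.minRep J w⁻¹)⁻¹

/-- The factor `_Jw ∈ W_J` of the left factorization `w = _Jw · ᴶw`. -/
noncomputable def leftParPart (J : Set B) (w : W) : W :=
  (cs.parPart J w⁻¹)⁻¹

theorem leftMinRep_not_isLeftDescent (J : Set B) (w : W) :
    ∀ j ∈ J, ¬ cs.IsLeftDescent (cs.leftMinRep J w) j := by
  intro j hj h
  refine cs.minRep_mem J w⁻¹ j hj ?_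
  simpa [leftMinRep, cs.isLeftDescent_inv_iff] using h

theorem leftParPart_mem (J : Set B) (w : W) : cs.leftParPart J w ∈ cs.parabolic J :=
  inv_mem (cs.parPart_mem J w⁻¹)

theorem leftParPart_mul_leftMinRep (J : Set B) (w : W) :
    cs.leftParPart J w * cs.leftMinRep J w = w := by
  rw [leftParPart, leftMinRep, ← mul_inv_rev, minRep_mul_parPart, inv_inv]

/-- `x` is the maximum of `W_J ∩ [e, w]`. -/
def IsParabolicMax (J : Set B) (w x : W) : Prop :=
  (x ∈ cs.parabolic J ∧ cs.BruhatLE x w) ∧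
    ∀ y, y ∈ cs.parabolic J → cs.BruhatLE y w → cs.BruhatLE y x

/-- `w₀(J)`: the maximum of `W_J ∩ [e, w]` (which always exists). -/
noncomputable def parabolicMax (J : Set B) (w : W) : W :=
  Classical.epsilon (cs.IsParabolicMax J w)

/-! ### Special matchings

Matchings of a lower interval `[e, w]` are represented by functions `W → W`, of which only the
values on `[e, w]` matter. -/

/-- `M` is a matching of (the Hasse diagram of) the lower Bruhat interval `[e, w]`. -/
structure IsMatching (w : W) (M : W → W) : Prop where
  mapsTo : ∀ u, cs.BruhatLE u w → cs.BruhatLE (M u) w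
  involutive : ∀ u, cs.BruhatLE u w → M (M u) = u
  edge : ∀ u, cs.BruhatLE u w → cs.BruhatCovBy u (M u) ∨ cs.BruhatCovBy (M u) u

/-- `M` is a special matching of `w`. -/
structure IsSpecialMatching (w : W) (M : W → W) : Prop extends cs.IsMatching w M where
  special : ∀ u v, cs.BruhatLE u w → cs.BruhatLE v w → cs.BruhatCovBy u v → M u ≠ v →
    cs.BruhatLE (M u) (M v)

/-- `M` is the left multiplication matching `λ_i` of `w` for some `i ∈ D_L(w)`. -/
def IsLeftMultMatching (w : W) (M : W → W) : Prop :=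
  ∃ i, cs.IsLeftDescent w i ∧ ∀ u, cs.BruhatLE u w → M u = cs.simple i * u

/-- `M` is the right multiplication matching `ρ_i` of `w` for some `i ∈ D_R(w)`. -/
def IsRightMultMatching (w : W) (M : W → W) : Prop :=
  ∃ i, cs.IsRightDescent w i ∧ ∀ u, cs.BruhatLE u w → M u = u * cs.simple i

/-- `M` and `N` commute on the set `A`. -/
def CommuteOn (A : Set W) (M N : W → W) : Prop :=
  ∀ u ∈ A, M (N u) = N (M u)

/-- All entries of the Coxeter matrix are finite (an entry `0` stands for `∞`) and at most 4. -/
def IsDoublyLaced (_cs : CoxeterSystem C W) : Prop :=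
  ∀ i j, C i j ≠ 0 ∧ C i j ≤ 4

/-! ### Right and left systems -/

/-- `(u^J)^{s,t} · M_st((u^J)_{s,t} · _{s}(u_J)) · ^{s}(u_J)`. -/
noncomputable def rightAction (J : Set B) (s t : B) (Mst : W → W) (u : W) : W :=
  cs.minRep {s, t} (cs.minRep J u) *
    Mst (cs.parPart {s, t} (cs.minRep J u) * cs.leftParPart {s} (cs.parPart J u)) *
    cs.leftMinRep {s} (cs.parPart J u)

/-- `(_Ju)^{s} · M_st((_Ju)_{s} · _{s,t}(ᴶu)) · ^{s,t}(ᴶu)`. -/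
noncomputable def leftAction (J : Set B) (s t : B) (Mst : W → W) (u : W) : W :=
  cs.minRep {s} (cs.leftParPart J u) *
    Mst (cs.parPart {s} (cs.leftParPart J u) * cs.leftParPart {s, t} (cs.leftMinRep J u)) *
    cs.leftMinRep {s, t} (cs.leftMinRep J u)

/-- `(J, s, t, M_st)` is a right system for `w`. -/
structure IsRightSystem (w : W) (J : Set B) (s t : B) (Mst : W → W) : Prop where
  s_mem : s ∈ J
  t_notMem : t ∉ J
  special : cs.IsSpecialMatching (cs.parabolicMax {s, t} w) Mst
  map_one : Mst 1 = cs.simple s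
  /-- The condition only makes sense when `t` lies in the domain `[e, w₀(s,t)]` of `M_st`. -/
  map_t : cs.BruhatLE (cs.simple t) (cs.parabolicMax {s, t} w) →
    Mst (cs.simple t) = cs.simple t * cs.simple s
  action_le : ∀ u, cs.BruhatLE u w → cs.BruhatLE (cs.rightAction J s t Mst u) w
  comm_s : ∀ r ∈ J, cs.BruhatLE (cs.simple r) (cs.minRep J w) →
    Commute (cs.simple r) (cs.simple s)
  both_le : cs.BruhatLE (cs.simple s) (cs.minRep {s, t} (cs.minRep J w)) →
    cs.BruhatLE (cs.simple t) (cs.minRep {s, t} (cs.minRep J w)) →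
    ∀ u, cs.BruhatLE u (cs.parabolicMax {s, t} w) → Mst u = u * cs.simple s
  s_le : cs.BruhatLE (cs.simple s) (cs.minRep {s, t} (cs.minRep J w)) →
    ¬ cs.BruhatLE (cs.simple t) (cs.minRep {s, t} (cs.minRep J w)) →
    CommuteOn {u | cs.BruhatLE u (cs.parabolicMax {s, t} w)} Mst (fun u => cs.simple s * u)
  t_le : ¬ cs.BruhatLE (cs.simple s) (cs.minRep {s, t} (cs.minRep J w)) →
    cs.BruhatLE (cs.simple t) (cs.minRep {s, t} (cs.minRep J w)) →
    CommuteOn {u | cs.BruhatLE u (cs.parabolicMax {s, t} w)} Mst (fun u => cs.simple t * u)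
  comm_mul : ∀ v, cs.BruhatLE v w →
    cs.BruhatLE (cs.simple s) (cs.leftMinRep {s} (cs.parPart J v)) →
    CommuteOn {u | cs.BruhatLE u v ∧ cs.BruhatLE u (cs.parabolicMax {s, t} w)}
      Mst (fun u => u * cs.simple s)

/-- `(J, s, t, M_st)` is a left system for `w`. -/
structure IsLeftSystem (w : W) (J : Set B) (s t : B) (Mst : W → W) : Prop where
  s_mem : s ∈ J
  t_notMem : t ∉ J
  special : cs.IsSpecialMatching (cs.parabolicMax {s, t} w) Mst
  map_one : Mst 1 = cs.simple s
  /-- The condition only makes sense when `t` lies in the domain `[e, w₀(s,t)]` of `M_st`. -/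
  map_t : cs.BruhatLE (cs.simple t) (cs.parabolicMax {s, t} w) →
    Mst (cs.simple t) = cs.simple s * cs.simple t
  action_le : ∀ u, cs.BruhatLE u w → cs.BruhatLE (cs.leftAction J s t Mst u) w
  comm_s : ∀ r ∈ J, cs.BruhatLE (cs.simple r) (cs.leftMinRep J w) →
    Commute (cs.simple r) (cs.simple s)
  both_le : cs.BruhatLE (cs.simple s) (cs.leftMinRep {s, t} (cs.leftMinRep J w)) →
    cs.BruhatLE (cs.simple t) (cs.leftMinRep {s, t} (cs.leftMinRep J w)) →
    ∀ u, cs.BruhatLE u (cs.parabolicMax {s, t} w) → Mst u = cs.simple s * u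
  s_le : cs.BruhatLE (cs.simple s) (cs.leftMinRep {s, t} (cs.leftMinRep J w)) →
    ¬ cs.BruhatLE (cs.simple t) (cs.leftMinRep {s, t} (cs.leftMinRep J w)) →
    CommuteOn {u | cs.BruhatLE u (cs.parabolicMax {s, t} w)} Mst (fun u => u * cs.simple s)
  t_le : ¬ cs.BruhatLE (cs.simple s) (cs.leftMinRep {s, t} (cs.leftMinRep J w)) →
    cs.BruhatLE (cs.simple t) (cs.leftMinRep {s, t} (cs.leftMinRep J w)) →
    CommuteOn {u | cs.BruhatLE u (cs.parabolicMax {s, t} w)} Mst (fun u => u * cs.simple t)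
  comm_mul : ∀ v, cs.BruhatLE v w →
    cs.BruhatLE (cs.simple s) (cs.minRep {s} (cs.leftParPart J v)) →
    CommuteOn {u | cs.BruhatLE u v ∧ cs.BruhatLE u (cs.parabolicMax {s, t} w)}
      Mst (fun u => cs.simple s * u)

end CoxeterSystem

/-! Every `u ≤ w` factors as `x · y₁ · y₂ · z`, with `x y₁ = u^J`, `y₂ z = u_J`, `x = (u^J)^{s,t}`
and `y₂ = _{s}(u_J)`. The action `M` touches only the dihedral block, replacing `y₁ y₂` by `M_st(y₁
y₂)`. The matching sought is `λ_l`, with `l` a left descent of the first nontrivial factor of `w`.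

Let `x₀` be the factor `x` of `w`, and suppose `x₀ ≠ 1`. For a left descent `l` of `x₀` and any `u ≤
w`, Deodhar's dichotomy leaves three possibilities. Either `l` is absorbed by `x`; or `l x = x p`
with `p ∈ {s,t}`, and condition 4 makes `M_st` commute with `λ_p`; or `l x y₁ = x y₁ j` with `j ∈ J`
outside `{s,t}`. In the last case condition 3 lets `j` cross `y₂` into `z`, and it must be shown
that `j` also crosses the block after `M_st` has acted (`rightAction_simple_mul`, with
`commute_of_conj_mem_parabolic`).

If `x₀ = 1`, then `w^J = y₁` is in `W_{s,t}` without right descent `s`, so `m(s,t) ≤ 4` leaves `1`,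
`t`, `st`, `tst`. For `1`, `M` is `λ_s`. For `t` and `st`, the prescribed values at `e` and `t` and
injectivity force `M_st = ρ_s`, which commutes with left multiplications (`exists_commuting`). For
`tst` one has `m(s,t) = 4`. If the dihedral maximum is `tst`, this is the first exception; if it is
`tsts`, then `st ↦ sts` forces `ρ_s`, while `st ↦ tst` gives the second exception (`exceptional`).

Part (B) is part (A) for `w⁻¹` and `u ↦ M(u⁻¹)⁻¹`. The Bruhat order facts rest on strong exchange,
obtained from the signed conjugation action. -/

namespace CoxeterSystem

variable {B W : Type*} [Group W] {C : CoxeterMatrix B} (cs : CoxeterSystem C W)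

/-! ### Injectivity of the simple reflections in the doubly laced case -/

/-- The Cartan coefficient attached to an entry of a doubly laced Coxeter matrix. -/
noncomputable def cartanCoeff : ℕ → ℝ
  | 1 => 2
  | 3 => -1
  | 4 => -√2
  -- The values are `-2 cos(π/m)`; the default branch supplies `m = 2`.
  | _ => 0

/-- The reflection of `B → ℝ` attached to `i` in the contragredient geometric representation. -/
noncomputable def geomReflection (C : CoxeterMatrix B) (i : B) : Equiv.Perm (B → ℝ) :=
  Function.Involutive.toPerm (fun f k => f k - cartanCoeff (C i k) * f i) (by
    intro f
    funext k
    simp only [C.diagonal, cartanCoeff]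
    ring)

theorem geomReflection_apply (i : B) (f : B → ℝ) (k : B) :
    geomReflection C i f k = f k - cartanCoeff (C i k) * f i := rfl

/-- As `1 ≤ m ≤ 4`, each braid relation is a finite computation using only `√2 · √2 = 2`. -/
theorem isLiftable_geomReflection (hdl : cs.IsDoublyLaced) :
    C.IsLiftable (geomReflection C) := by
  intro i j
  obtain ⟨h0, h4⟩ := hdl i j
  have hij : C j i = C i j := C.symmetric j i
  have hs : √2 * √2 = (2 : ℝ) := Real.mul_self_sqrt (by norm_num)
  ext f k
  rcases (by omega : C i j = 1 ∨ C i j = 2 ∨ C i j = 3 ∨ C i j = 4) with h | h | h | h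
  · have : i = j := by
      by_contra hne
      exact C.off_diagonal i j hne h
    subst this
    simp [geomReflection_apply, cartanCoeff]
    ring
  all_goals
    rw [h] at hij
    simp only [h, pow_succ, pow_zero, one_mul, Equiv.Perm.mul_apply, geomReflection_apply,
      Equiv.Perm.one_apply, C.diagonal, hij, cartanCoeff]
  · ring
  · ring
  · generalize √2 = a at hs
    generalize cartanCoeff (C i k) = b
    generalize cartanCoeff (C j k) = c
    have h2 : a ^ 2 = 2 := by rw [pow_two, hs]
    have h3 : a ^ 3 = 2 * a := by rw [pow_succ, h2]
    have h4 : a ^ 4 = 4 := by rw [pow_succ, h3]; linear_combination 2 * hs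
    have h5 : a ^ 5 = 4 * a := by rw [pow_succ, h4]
    have h6 : a ^ 6 = 8 := by rw [pow_succ, h5]; linear_combination 4 * hs
    have h7 : a ^ 7 = 8 * a := by rw [pow_succ, h6]
    ring_nf
    simp only [h2, h3, h4, h5, h6, h7]
    ring

/-- On the indicator function of `i`, the reflection of `i` changes the value at `i` to `-1`, while
that of `j ≠ i` leaves it equal to `1`. -/
theorem simple_injective (hdl : cs.IsDoublyLaced) : Function.Injective cs.simple := by
  classical
  intro i j hij
  by_contra hne
  have h := congrArg (cs.lift ⟨_, cs.isLiftable_geomReflection hdl⟩) hij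
  rw [lift_apply_simple, lift_apply_simple] at h
  have h1 := congrFun (Equiv.congr_fun h (Pi.single i 1)) i
  norm_num [geomReflection_apply, cartanCoeff, Pi.single_eq_of_ne (Ne.symm hne)] at h1

/-! ### The strong exchange property -/

open Classical in
/-- The involution `(x, ε) ↦ (s x s, ε + [x = s])` attached to the simple reflection `s`. -/
noncomputable def signReflection (i : B) : Equiv.Perm (W × ZMod 2) :=
  Function.Involutive.toPerm
    (fun p => (cs.simple i * p.1 * cs.simple i, p.2 + if p.1 = cs.simple i then 1 else 0)) (by
    rintro ⟨x, ε⟩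
    have h : cs.simple i * x * cs.simple i = cs.simple i ↔ x = cs.simple i := by
      rw [mul_assoc, mul_eq_left, mul_eq_one_iff_eq_inv, inv_simple]
    ext
    · simp [mul_assoc]
    · simp only [h, add_assoc]
      split_ifs
      · have : (1 + 1 : ZMod 2) = 0 := rfl
        rw [this, add_zero]
      · simp)

open Classical in
theorem signReflection_apply (i : B) (x : W) (ε : ZMod 2) : cs.signReflection i (x, ε) =
    (cs.simple i * x * cs.simple i, ε + if x = cs.simple i then 1 else 0) := rfl

-- With `c = s_i s_j`, the reflections met along the alternating word of length `2k` are `c⁻ⁿ s_j`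
-- for `n < 2k`; the sum counts how often `x` is among them.
open Classical in
theorem signReflection_mul_pow_apply (i j : B) (k : ℕ) (x : W) (ε : ZMod 2) :
    ((cs.signReflection i * cs.signReflection j) ^ k) (x, ε) =
      ((cs.simple i * cs.simple j) ^ k * x * ((cs.simple i * cs.simple j) ^ k)⁻¹,
        ε + ∑ n ∈ Finset.range (2 * k),
          if x = ((cs.simple i * cs.simple j) ^ n)⁻¹ * cs.simple j then 1 else 0) := by
  set c := cs.simple i * cs.simple j with hc
  have hjc : ∀ n : ℕ, cs.simple j * c ^ n = (c ^ n)⁻¹ * cs.simple j := by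
    intro n
    have h1 : cs.simple j * c * cs.simple j = c⁻¹ := by
      simp [hc, mul_assoc]
    have h2 : cs.simple j * c ^ n * cs.simple j = (c ^ n)⁻¹ := by
      have := conj_pow (i := n) (a := cs.simple j) (b := c)
      rw [inv_simple, h1] at this
      rw [← this, inv_pow]
    rw [← h2, mul_assoc, mul_assoc]
    simp
  have hjc1 : cs.simple j * c = c⁻¹ * cs.simple j := by simpa using hjc 1
  induction k with
  | zero => simp
  | succ k ih =>
    rw [pow_succ', Equiv.Perm.mul_apply, ih, Equiv.Perm.mul_apply, signReflection_apply,
      signReflection_apply, mul_add, mul_one, Finset.sum_range_succ, Finset.sum_range_succ]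
    have e1 : c ^ k * x * (c ^ k)⁻¹ = cs.simple j ↔ x = (c ^ (2 * k))⁻¹ * cs.simple j := by
      rw [mul_inv_eq_iff_eq_mul, ← eq_inv_mul_iff_mul_eq, hjc, two_mul, pow_add, mul_inv_rev,
        mul_assoc]
    have e2 : cs.simple j * (c ^ k * x * (c ^ k)⁻¹) * cs.simple j = cs.simple i ↔
        x = (c ^ (2 * k + 1))⁻¹ * cs.simple j := by
      have h3 : cs.simple j * (c ^ k * x * (c ^ k)⁻¹) * cs.simple j = cs.simple i ↔
          c ^ k * x * (c ^ k)⁻¹ = c⁻¹ * cs.simple j := by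
        rw [← eq_mul_inv_iff_mul_eq, inv_simple, ← hc, ← eq_inv_mul_iff_mul_eq, inv_simple]
        rw [← hjc1]
      rw [h3, mul_inv_eq_iff_eq_mul, mul_assoc, hjc, ← eq_inv_mul_iff_mul_eq, two_mul,
        add_assoc, pow_add, pow_succ]
      simp only [mul_inv_rev, mul_assoc]
      have hcomm : ∀ y : W, (c ^ k)⁻¹ * (c⁻¹ * y) = c⁻¹ * ((c ^ k)⁻¹ * y) := by
        intro y
        rw [← mul_assoc, ← mul_assoc, ← mul_inv_rev, ← mul_inv_rev, pow_mul_comm']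
      simp only [hcomm]
    ext
    · simp only [pow_succ', hc, mul_inv_rev, inv_simple, mul_assoc]
    · simp only [e1, e2, add_assoc]

/-- For `k = m(i,j)` the list of `2m` reflections has period `m`, so each `x` is counted an even
number of times. -/
theorem isLiftable_signReflection : C.IsLiftable cs.signReflection := by
  classical
  intro i j
  ext1 ⟨x, ε⟩
  rw [signReflection_mul_pow_apply, simple_mul_simple_pow, two_mul, Finset.sum_range_add]
  have h : ∀ n, (cs.simple i * cs.simple j) ^ (C i j + n) = (cs.simple i * cs.simple j) ^ n := by
    intro n
    rw [pow_add, simple_mul_simple_pow, one_mul]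
  simp only [h]
  rw [CharTwo.add_self_eq_zero]
  simp

/-- The action of `W` on `W × ZMod 2` by signed conjugation. -/
noncomputable def signAction : W →* Equiv.Perm (W × ZMod 2) :=
  cs.lift ⟨cs.signReflection, cs.isLiftable_signReflection⟩

theorem signAction_simple (i : B) : cs.signAction (cs.simple i) = cs.signReflection i :=
  cs.lift_apply_simple _ i

-- The sign records the parity of the multiplicity of `x` in the right inversion sequence. This
-- parity therefore depends on the group element only, not on the word.
open Classical in
theorem signAction_wordProd (ω : List B) (x : W) (ε : ZMod 2) :
    cs.signAction (cs.wordProd ω) (x, ε) =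
      (cs.wordProd ω * x * (cs.wordProd ω)⁻¹, ε + ((cs.rightInvSeq ω).count x : ZMod 2)) := by
  induction ω with
  | nil => simp
  | cons i ω ih =>
    rw [wordProd_cons, map_mul, Equiv.Perm.mul_apply, ih, signAction_simple,
      signReflection_apply, rightInvSeq, List.count_cons]
    have h : cs.wordProd ω * x * (cs.wordProd ω)⁻¹ = cs.simple i ↔
        (cs.wordProd ω)⁻¹ * cs.simple i * cs.wordProd ω = x := by
      rw [mul_inv_eq_iff_eq_mul, ← eq_inv_mul_iff_mul_eq, mul_assoc, eq_comm]
    ext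
    · simp [mul_assoc]
    · simp only [h, beq_iff_eq, Nat.cast_add, Nat.cast_ite, Nat.cast_one, Nat.cast_zero, add_assoc]

theorem signAction_apply (w x : W) (ε : ZMod 2) :
    cs.signAction w (x, ε) = (w * x * w⁻¹, ε + (cs.signAction w (x, 0)).2) := by
  classical
  obtain ⟨ω, rfl⟩ := cs.wordProd_surjective w
  simp [signAction_wordProd]

/-- For `τ = u s u⁻¹` the signs contributed by `u` and `u⁻¹` cancel, leaving the flip that `s` makes
on itself. -/
theorem signAction_reflection {τ : W} (hτ : cs.IsReflection τ) (ε : ZMod 2) :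
    cs.signAction τ (τ, ε) = (τ, ε + 1) := by
  obtain ⟨u, i, rfl⟩ := hτ
  set τ := u * cs.simple i * u⁻¹ with hτ
  have h1 : cs.signAction u (cs.simple i, (cs.signAction u⁻¹ (τ, ε)).2) = (τ, ε) := by
    have h : cs.signAction u⁻¹ (τ, ε) = (cs.simple i, (cs.signAction u⁻¹ (τ, ε)).2) := by
      rw [signAction_apply]
      simp [hτ, mul_assoc]
    rw [← h, ← Equiv.Perm.mul_apply, ← map_mul]
    simp
  have h2 : cs.signAction u⁻¹ (τ, ε) = (cs.simple i, (cs.signAction u⁻¹ (τ, ε)).2) := by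
    rw [signAction_apply]
    simp [hτ, mul_assoc]
  rw [signAction_apply] at h1
  have h3 := congrArg Prod.snd h1
  simp only at h3
  conv_lhs => rw [hτ, map_mul, map_mul, ← hτ, Equiv.Perm.mul_apply, h2, Equiv.Perm.mul_apply,
    signAction_simple, signReflection_apply, signAction_apply]
  ext
  · simp [hτ]
  · simp only [simple_mul_simple_self, one_mul, if_true]
    rw [add_right_comm, h3]

/-- The strong exchange property. -/
theorem exists_eraseIdx_of_length_lt {τ : W} (hτ : cs.IsReflection τ) (ω : List B)
    (h : cs.length (cs.wordProd ω * τ) < cs.length (cs.wordProd ω)) :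
    ∃ k < ω.length, cs.wordProd ω * τ = cs.wordProd (ω.eraseIdx k) := by
  classical
  have key : ∀ ω' : List B, (cs.signAction (cs.wordProd ω') (τ, 0)).2 ≠ 0 →
      ∃ k < ω'.length, cs.wordProd ω' * τ = cs.wordProd (ω'.eraseIdx k) := by
    intro ω' h0
    have hmem : τ ∈ cs.rightInvSeq ω' := by
      by_contra hn
      apply h0
      rw [signAction_wordProd, List.count_eq_zero_of_not_mem hn]
      simp
    obtain ⟨k, hk, rfl⟩ := List.mem_iff_getElem.1 hmem
    rw [length_rightInvSeq] at hk
    refine ⟨k, hk, ?_⟩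
    rw [← wordProd_mul_getD_rightInvSeq, List.getD_eq_getElem _ _ (by simpa using hk)]
  by_cases h0 : (cs.signAction (cs.wordProd ω) (τ, 0)).2 = 0
  · exfalso
    -- Even parity for `v` (the product of `ω`) means odd parity for `vτ`; deletion then makes `v =
    -- (vτ)τ` shorter than `vτ`, against the hypothesis.
    obtain ⟨ω', hω', he⟩ := cs.exists_isReduced (cs.wordProd ω * τ)
    have h1 : (cs.signAction (cs.wordProd ω') (τ, 0)).2 ≠ 0 := by
      rw [← he, map_mul, Equiv.Perm.mul_apply, cs.signAction_reflection hτ, signAction_apply, h0]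
      simp
    obtain ⟨k, hk, hk'⟩ := key ω' h1
    rw [← he, mul_assoc, hτ.mul_self, mul_one] at hk'
    have h2 := cs.length_wordProd_le (ω'.eraseIdx k)
    rw [← hk', List.length_eraseIdx_of_lt hk] at h2
    rw [he, hω'.eq] at h
    omega
  · exact key ω h0

/-! ### Basic properties of the Bruhat order -/

theorem bruhatLE_refl (u : W) : cs.BruhatLE u u := Relation.ReflTransGen.refl

variable {cs} in
theorem BruhatLE.trans {u v w : W} (h : cs.BruhatLE u v) (h' : cs.BruhatLE v w) :
    cs.BruhatLE u w := Relation.ReflTransGen.trans h h'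

variable {cs} in
theorem BruhatLE.length_le {u v : W} (h : cs.BruhatLE u v) : cs.length u ≤ cs.length v := by
  induction h with
  | refl => exact le_rfl
  | tail _ h ih => exact ih.trans h.2.le

variable {cs} in
theorem BruhatLE.eq_of_length_le {u v : W} (h : cs.BruhatLE u v)
    (hl : cs.length v ≤ cs.length u) : u = v := by
  cases h with
  | refl => rfl
  | tail h' h =>
    have := BruhatLE.length_le h'
    have := h.2
    omega

variable {cs} in
theorem BruhatLE.antisymm {u v : W} (h : cs.BruhatLE u v) (h' : cs.BruhatLE v u) : u = v :=
  h.eq_of_length_le h'.length_le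

theorem bruhatLE_mul_simple {u : W} {i : B} (h : ¬ cs.IsRightDescent u i) :
    cs.BruhatLE u (u * cs.simple i) := by
  refine Relation.ReflTransGen.single ⟨?_, ?_⟩
  · rw [inv_mul_cancel_left]
    exact cs.isReflection_simple i
  · have := cs.not_isRightDescent_iff.1 h
    omega

theorem mul_simple_bruhatLE {u : W} {i : B} (h : cs.IsRightDescent u i) :
    cs.BruhatLE (u * cs.simple i) u := by
  have := cs.bruhatLE_mul_simple (cs.isRightDescent_iff_not_isRightDescent_mul.1 h)
  simpa using this

variable {cs} in
theorem BruhatEdge.inv {u v : W} (h : cs.BruhatEdge u v) : cs.BruhatEdge u⁻¹ v⁻¹ := by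
  refine ⟨?_, by simpa using h.2⟩
  have h1 := (h.1.conj v).inv
  have h2 : v * (u⁻¹ * v) * v⁻¹ = v * u⁻¹ := by group
  rw [h2] at h1
  have h3 := h.1.conj v
  rw [h2, ← h1] at h3
  simpa using h3

variable {cs} in
theorem BruhatLE.inv {u v : W} (h : cs.BruhatLE u v) : cs.BruhatLE u⁻¹ v⁻¹ := by
  induction h with
  | refl => exact cs.bruhatLE_refl _
  | tail _ h ih => exact ih.tail h.inv

theorem bruhatLE_inv_iff {u v : W} : cs.BruhatLE u⁻¹ v⁻¹ ↔ cs.BruhatLE u v :=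
  ⟨fun h => by simpa using h.inv, BruhatLE.inv⟩

theorem bruhatLE_inv_comm {u v : W} : cs.BruhatLE u⁻¹ v ↔ cs.BruhatLE u v⁻¹ := by
  rw [← bruhatLE_inv_iff, inv_inv]

-- Otherwise `vs` is shorter than `us`, and strong exchange deletes a letter from a reduced word of
-- `u` followed by `s`. Deleting a letter of `u` makes `v` shorter than `u`; deleting the last `s`
-- gives `vs = u`, which is excluded.
variable {cs} in
theorem BruhatEdge.mul_simple {u v : W} (h : cs.BruhatEdge u v) (i : B)
    (hne : v ≠ u * cs.simple i) : cs.BruhatEdge (u * cs.simple i) (v * cs.simple i) := by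
  obtain ⟨hτ, hl⟩ := h
  have hr : cs.IsReflection ((u * cs.simple i)⁻¹ * (v * cs.simple i)) := by
    have := hτ.conj (cs.simple i)
    rw [inv_simple] at this
    simpa [mul_assoc] using this
  refine ⟨hr, ?_⟩
  by_contra hcon
  have hvs : v * cs.simple i =
      (u * cs.simple i) * ((u * cs.simple i)⁻¹ * (v * cs.simple i)) := by group
  have hne' := hr.length_mul_left_ne (u * cs.simple i)
  rw [← hvs] at hne'
  have hlt : cs.length (v * cs.simple i) < cs.length (u * cs.simple i) := by omega
  obtain ⟨ω, hω, rfl⟩ := cs.exists_isReduced u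
  rw [hω.eq] at hl
  rw [hvs, ← wordProd_concat] at hlt
  obtain ⟨k, hk, he⟩ := cs.exists_eraseIdx_of_length_lt (by rw [wordProd_concat]; exact hr) _ hlt
  rw [wordProd_concat, ← hvs] at he
  simp only [List.concat_eq_append, List.length_append, List.length_singleton] at hk he
  rcases (by omega : k < ω.length ∨ k = ω.length) with h | h
  · rw [List.eraseIdx_append_of_lt_length h, wordProd_append, wordProd_singleton,
      mul_left_inj] at he
    have := cs.length_wordProd_le (ω.eraseIdx k)
    rw [← he, List.length_eraseIdx_of_lt h] at this
    omega
  · subst h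
    rw [List.eraseIdx_append_of_length_le le_rfl] at he
    simp only [Nat.sub_self, List.eraseIdx_cons_zero, List.append_nil] at he
    exact hne (by rw [← he, mul_assoc, simple_mul_simple_self, mul_one])

-- This is the lifting property: a Bruhat chain is multiplied by `s` edge by edge, and an edge `a →
-- as` shortcuts it.
variable {cs} in
theorem BruhatLE.mul_simple_or {u v : W} (h : cs.BruhatLE u v) (i : B) :
    cs.BruhatLE (u * cs.simple i) v ∨ cs.BruhatLE (u * cs.simple i) (v * cs.simple i) := by
  induction h with
  | refl => exact Or.inr (cs.bruhatLE_refl _)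
  | @tail a b _ h ih =>
    rcases ih with ih | ih
    · exact Or.inl (ih.tail h)
    · by_cases hb : b = a * cs.simple i
      · exact Or.inl (hb ▸ ih)
      · exact Or.inr (ih.tail (h.mul_simple i hb))

variable {cs} in
theorem BruhatLE.or_mul_simple {u v : W} (h : cs.BruhatLE u v) (i : B) :
    cs.BruhatLE u (v * cs.simple i) ∨ cs.BruhatLE (u * cs.simple i) (v * cs.simple i) := by
  induction h with
  | refl => exact Or.inr (cs.bruhatLE_refl _)
  | @tail a b hab h ih =>
    by_cases hb : b = a * cs.simple i
    · left
      rw [hb, mul_assoc, simple_mul_simple_self, mul_one]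
      exact hab
    · exact ih.imp (fun ih => ih.tail (h.mul_simple i hb)) (fun ih => ih.tail (h.mul_simple i hb))

variable {cs} in
theorem BruhatLE.mul_simple_of_isRightDescent {u v : W} (h : cs.BruhatLE u v) {i : B}
    (hv : cs.IsRightDescent v i) : cs.BruhatLE (u * cs.simple i) v :=
  (h.mul_simple_or i).elim id fun h' => h'.trans (cs.mul_simple_bruhatLE hv)

variable {cs} in
theorem BruhatLE.of_not_isRightDescent {u v : W} (h : cs.BruhatLE u v) {i : B}
    (hu : ¬ cs.IsRightDescent u i) : cs.BruhatLE u (v * cs.simple i) :=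
  (h.or_mul_simple i).elim id fun h' => (cs.bruhatLE_mul_simple hu).trans h'

variable {cs} in
theorem BruhatLE.mul_simple_mul_simple {u v : W} (h : cs.BruhatLE u v) {i : B}
    (hu : cs.IsRightDescent u i) : cs.BruhatLE (u * cs.simple i) (v * cs.simple i) :=
  (h.or_mul_simple i).elim (fun h' => (cs.mul_simple_bruhatLE hu).trans h') id

variable {cs} in
theorem BruhatLE.simple_mul_of_isLeftDescent {u v : W} (h : cs.BruhatLE u v) {i : B}
    (hv : cs.IsLeftDescent v i) : cs.BruhatLE (cs.simple i * u) v := by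
  rw [← bruhatLE_inv_iff, mul_inv_rev, inv_simple]
  exact h.inv.mul_simple_of_isRightDescent (by rwa [isRightDescent_inv_iff])

theorem bruhatLE_mul_right {a b : W} (h : cs.length (a * b) = cs.length a + cs.length b) :
    cs.BruhatLE a (a * b) := by
  obtain ⟨ω, hω, rfl⟩ := cs.exists_isReduced b
  rw [hω.eq] at h
  clear hω
  induction ω using List.reverseRecOn with
  | nil => simpa using cs.bruhatLE_refl a
  | append_singleton ω i ih =>
    rw [wordProd_append, wordProd_singleton, ← mul_assoc, List.length_append,
      List.length_singleton] at h
    rw [wordProd_append, wordProd_singleton, ← mul_assoc]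
    have h1 := cs.length_mul_simple (a * cs.wordProd ω) i
    have h2 := cs.length_mul_le a (cs.wordProd ω)
    have h3 := cs.length_wordProd_le ω
    refine (ih (by omega)).trans (cs.bruhatLE_mul_simple ?_)
    rw [IsRightDescent]
    omega

theorem bruhatLE_mul_left {a b : W} (h : cs.length (a * b) = cs.length a + cs.length b) :
    cs.BruhatLE b (a * b) := by
  rw [← bruhatLE_inv_iff, mul_inv_rev]
  refine cs.bruhatLE_mul_right ?_
  rw [← mul_inv_rev, length_inv, length_inv, length_inv, h, add_comm]

theorem one_bruhatLE (u : W) : cs.BruhatLE 1 u := by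
  simpa using cs.bruhatLE_mul_right (a := 1) (b := u) (by simp)

theorem simple_bruhatLE_of_isLeftDescent {u : W} {i : B} (h : cs.IsLeftDescent u i) :
    cs.BruhatLE (cs.simple i) u := by
  simpa using (cs.one_bruhatLE u).simple_mul_of_isLeftDescent h

/-! ### Parabolic subgroups -/

theorem simple_mem_parabolic {J : Set B} {i : B} (hi : i ∈ J) : cs.simple i ∈ cs.parabolic J :=
  Subgroup.subset_closure ⟨i, hi, rfl⟩

theorem wordProd_mem_parabolic {J : Set B} {ω : List B} (h : ∀ i ∈ ω, i ∈ J) :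
    cs.wordProd ω ∈ cs.parabolic J := by
  refine Subgroup.list_prod_mem _ fun x hx => ?_
  obtain ⟨i, hi, rfl⟩ := List.mem_map.1 hx
  exact cs.simple_mem_parabolic (h i hi)

theorem exists_word_of_mem_parabolic {J : Set B} {u : W} (h : u ∈ cs.parabolic J) :
    ∃ ω : List B, (∀ i ∈ ω, i ∈ J) ∧ u = cs.wordProd ω := by
  induction h using Subgroup.closure_induction with
  | mem x hx =>
    obtain ⟨i, hi, rfl⟩ := hx
    exact ⟨[i], by simpa using hi, by simp⟩
  | one => exact ⟨[], by simp, by simp⟩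
  | mul x y _ _ hx hy =>
    obtain ⟨ω, hω, rfl⟩ := hx
    obtain ⟨ω', hω', rfl⟩ := hy
    refine ⟨ω ++ ω', fun i hi => ?_, (cs.wordProd_append _ _).symm⟩
    exact (List.mem_append.1 hi).elim (hω i) (hω' i)
  | inv x _ hx =>
    obtain ⟨ω, hω, rfl⟩ := hx
    exact ⟨ω.reverse, by simpa using hω, (cs.wordProd_reverse _).symm⟩

theorem parabolic_mono {J K : Set B} (h : J ⊆ K) : cs.parabolic J ≤ cs.parabolic K :=
  Subgroup.closure_mono (Set.image_mono h)

-- By strong exchange, going down an edge deletes a letter from a word, so no letter outside `J` can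
-- appear.
variable {cs} in
theorem BruhatLE.mem_parabolic {J : Set B} {u v : W} (h : cs.BruhatLE u v)
    (hv : v ∈ cs.parabolic J) : u ∈ cs.parabolic J := by
  induction h using Relation.ReflTransGen.head_induction_on with
  | refl => exact hv
  | @head a b hab _ ih =>
    obtain ⟨ω, hω, rfl⟩ := cs.exists_word_of_mem_parabolic ih
    have e : cs.wordProd ω * (a⁻¹ * cs.wordProd ω)⁻¹ = a := by group
    obtain ⟨k, _, he⟩ := cs.exists_eraseIdx_of_length_lt hab.1.isReflection_inv ω
      (by rw [e]; exact hab.2)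
    rw [← e, he]
    exact cs.wordProd_mem_parabolic fun i hi => hω i (List.eraseIdx_subset hi)

-- Multiply by the letters of `b` one at a time: `a` has no right descent in `J`, so lifting keeps
-- it below. Uniqueness of minimal representatives and monotonicity of `u ↦ u^J` both follow from
-- this.
variable {cs} in
theorem BruhatLE.mul_of_mem_parabolic {J : Set B} {a v b : W} (h : cs.BruhatLE a v)
    (ha : a ∈ cs.minCosetReps J) (hb : b ∈ cs.parabolic J) : cs.BruhatLE a (v * b) := by
  obtain ⟨ω, hω, rfl⟩ := cs.exists_word_of_mem_parabolic hb
  clear hb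
  induction ω generalizing v with
  | nil => simpa using h
  | cons i ω ih =>
    rw [wordProd_cons, ← mul_assoc]
    exact ih (h.of_not_isRightDescent (ha i (hω i (by simp)))) fun j hj => hω j (by simp [hj])

theorem eq_of_mem_minCosetReps {J : Set B} {a b : W} (ha : a ∈ cs.minCosetReps J)
    (hb : b ∈ cs.minCosetReps J) (h : a⁻¹ * b ∈ cs.parabolic J) : a = b := by
  have h1 := (cs.bruhatLE_refl a).mul_of_mem_parabolic ha h
  have h2 := (cs.bruhatLE_refl b).mul_of_mem_parabolic hb (inv_mem h)
  rw [mul_inv_cancel_left] at h1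
  rw [mul_inv_rev, inv_inv, mul_inv_cancel_left] at h2
  exact h1.antisymm h2

theorem minRep_mul {J : Set B} {x p : W} (hx : x ∈ cs.minCosetReps J)
    (hp : p ∈ cs.parabolic J) : cs.minRep J (x * p) = x := by
  refine (cs.eq_of_mem_minCosetReps hx (cs.minRep_mem J _) ?_).symm
  have h := mul_mem hp (inv_mem (cs.parPart_mem J (x * p)))
  rw [parPart] at h
  have e : p * ((cs.minRep J (x * p))⁻¹ * (x * p))⁻¹ = x⁻¹ * cs.minRep J (x * p) := by group
  rwa [e] at h

theorem parPart_mul {J : Set B} {x p : W} (hx : x ∈ cs.minCosetReps J)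
    (hp : p ∈ cs.parabolic J) : cs.parPart J (x * p) = p := by
  rw [parPart, cs.minRep_mul hx hp, inv_mul_cancel_left]

theorem leftMinRep_mul {J : Set B} {x p : W} (hx : ∀ j ∈ J, ¬ cs.IsLeftDescent x j)
    (hp : p ∈ cs.parabolic J) : cs.leftMinRep J (p * x) = x := by
  rw [leftMinRep, mul_inv_rev, cs.minRep_mul _ (inv_mem hp), inv_inv]
  intro j hj
  rw [isRightDescent_inv_iff]
  exact hx j hj

theorem leftParPart_mul {J : Set B} {x p : W} (hx : ∀ j ∈ J, ¬ cs.IsLeftDescent x j)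
    (hp : p ∈ cs.parabolic J) : cs.leftParPart J (p * x) = p := by
  rw [leftParPart, mul_inv_rev, cs.parPart_mul _ (inv_mem hp), inv_inv]
  intro j hj
  rw [isRightDescent_inv_iff]
  exact hx j hj

theorem one_mem_minCosetReps (J : Set B) : (1 : W) ∈ cs.minCosetReps J :=
  fun j _ => cs.not_isRightDescent_one j

theorem exists_isRightDescent_of_mem_parabolic {J : Set B} {b : W} (hb : b ∈ cs.parabolic J)
    (hne : b ≠ 1) : ∃ j ∈ J, cs.IsRightDescent b j := by
  by_contra! h
  exact hne (cs.eq_of_mem_minCosetReps (cs.one_mem_minCosetReps J) h (by simpa using hb)).symm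

/-- Induct by removing a right descent `j` of `b = b' j`. If `a b'` got shorter on restoring `j`,
exchange would delete a letter of `a`, giving an element of `a W_J` shorter than its minimum, or a
letter of `b'`, making `b` shorter than `b'`. -/
theorem length_mul_of_mem_minCosetReps {J : Set B} {a b : W} (ha : a ∈ cs.minCosetReps J)
    (hb : b ∈ cs.parabolic J) : cs.length (a * b) = cs.length a + cs.length b := by
  induction hn : cs.length b using Nat.strong_induction_on generalizing b with
  | _ n ih =>
    by_cases h1 : b = 1
    · subst h1
      simp at hn
      simp [hn]
    obtain ⟨j, hj, hd⟩ := cs.exists_isRightDescent_of_mem_parabolic hb h1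
    set b' := b * cs.simple j with hb'
    have hbb : b = b' * cs.simple j := by simp [hb']
    have hd' : cs.length b' + 1 = cs.length b := cs.isRightDescent_iff.1 hd
    have hbJ : b' ∈ cs.parabolic J := mul_mem hb (cs.simple_mem_parabolic hj)
    have hl := ih (cs.length b') (by omega) hbJ rfl
    rw [hbb, ← mul_assoc]
    rcases cs.length_mul_simple (a * b') j with h | h
    · omega
    exfalso
    obtain ⟨ω₁, hω₁, rfl⟩ := cs.exists_isReduced a
    obtain ⟨ω₂, hω₂, e₂⟩ := cs.exists_isReduced b'
    have hlt : cs.length (cs.wordProd (ω₁ ++ ω₂) * cs.simple j) <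
        cs.length (cs.wordProd (ω₁ ++ ω₂)) := by
      rw [wordProd_append, ← e₂]
      omega
    obtain ⟨k, hk, he⟩ := cs.exists_eraseIdx_of_length_lt (cs.isReflection_simple j) _ hlt
    rw [wordProd_append, ← e₂] at he
    rcases lt_or_ge k ω₁.length with h2 | h2
    · rw [List.eraseIdx_append_of_lt_length h2, wordProd_append, ← e₂] at he
      have h3 := (cs.bruhatLE_refl (cs.wordProd ω₁)).mul_of_mem_parabolic ha
        (b := b' * cs.simple j * b'⁻¹)
        (mul_mem (mul_mem hbJ (cs.simple_mem_parabolic hj)) (inv_mem hbJ))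
      have h4 : cs.wordProd ω₁ * (b' * cs.simple j * b'⁻¹) = cs.wordProd (ω₁.eraseIdx k) := by
        rw [← mul_assoc, ← mul_assoc, he, mul_inv_cancel_right]
      rw [h4] at h3
      have h5 := h3.length_le
      have h6 := cs.length_wordProd_le (ω₁.eraseIdx k)
      rw [List.length_eraseIdx_of_lt h2] at h6
      rw [hω₁.eq] at h5
      omega
    · rw [List.eraseIdx_append_of_length_le h2, wordProd_append, mul_assoc,
        mul_right_inj, ← hbb] at he
      have h6 := cs.length_wordProd_le (ω₂.eraseIdx (k - ω₁.length))
      rw [List.length_append] at hk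
      rw [← he, List.length_eraseIdx_of_lt (by omega), ← hω₂.eq, ← e₂] at h6
      omega

theorem length_mul_of_not_isLeftDescent {J : Set B} {a b : W} (ha : a ∈ cs.parabolic J)
    (hb : ∀ j ∈ J, ¬ cs.IsLeftDescent b j) :
    cs.length (a * b) = cs.length a + cs.length b := by
  rw [← length_inv, mul_inv_rev, cs.length_mul_of_mem_minCosetReps (J := J) _ (inv_mem ha),
    length_inv, length_inv, add_comm]
  intro j hj
  rw [isRightDescent_inv_iff]
  exact hb j hj

theorem isRightDescent_mul_iff {J : Set B} {a b : W} (ha : a ∈ cs.minCosetReps J)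
    (hb : b ∈ cs.parabolic J) {j : B} (hj : j ∈ J) :
    cs.IsRightDescent (a * b) j ↔ cs.IsRightDescent b j := by
  rw [IsRightDescent, IsRightDescent, mul_assoc, cs.length_mul_of_mem_minCosetReps ha hb,
    cs.length_mul_of_mem_minCosetReps ha (mul_mem hb (cs.simple_mem_parabolic hj))]
  omega

variable {cs} in
theorem BruhatLE.minRep {u v : W} (h : cs.BruhatLE u v) (J : Set B) :
    cs.BruhatLE (cs.minRep J u) (cs.minRep J v) := by
  have h1 : cs.BruhatLE (cs.minRep J u) u := by
    have := (cs.bruhatLE_refl (cs.minRep J u)).mul_of_mem_parabolic (cs.minRep_mem J u)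
      (cs.parPart_mem J u)
    rwa [minRep_mul_parPart] at this
  have h2 := (h1.trans h).mul_of_mem_parabolic (cs.minRep_mem J u) (inv_mem (cs.parPart_mem J v))
  have e : v * (cs.parPart J v)⁻¹ = cs.minRep J v := by simp [parPart]
  rwa [e] at h2

theorem mem_parabolic_support (u : W) :
    u ∈ cs.parabolic {i | cs.BruhatLE (cs.simple i) u} := by
  obtain ⟨ω, hω, rfl⟩ := cs.exists_isReduced u
  refine cs.wordProd_mem_parabolic fun i hi => ?_
  obtain ⟨l, r, rfl⟩ := List.append_of_mem hi
  have h := hω.eq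
  have h1 : cs.wordProd (l ++ i :: r) = cs.wordProd l * (cs.simple i * cs.wordProd r) := by
    rw [wordProd_append, wordProd_cons]
  simp only [List.length_append, List.length_cons] at h
  have hl := cs.length_wordProd_le l
  have hr := cs.length_wordProd_le r
  have h2 := cs.length_mul_le (cs.wordProd l) (cs.simple i * cs.wordProd r)
  have h3 := cs.length_mul_le (cs.simple i) (cs.wordProd r)
  have h4 := cs.length_simple i
  show cs.BruhatLE _ _
  rw [h1] at h ⊢
  exact (cs.bruhatLE_mul_right (a := cs.simple i) (b := cs.wordProd r) (by omega)).trans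
    (cs.bruhatLE_mul_left (by omega))

theorem mem_of_simple_mem_parabolic (hinj : Function.Injective cs.simple) {J : Set B} {i : B}
    (h : cs.simple i ∈ cs.parabolic J) : i ∈ J := by
  have hne : cs.simple i ≠ 1 := by
    intro h
    have := cs.length_simple i
    rw [h, length_one] at this
    omega
  obtain ⟨j, hj, hd⟩ := cs.exists_isRightDescent_of_mem_parabolic h hne
  have h1 : cs.length (cs.simple i * cs.simple j) < 1 := by
    simpa [IsRightDescent] using hd
  have h2 : cs.simple i * cs.simple j = 1 := by
    rw [← cs.length_eq_zero_iff]
    omega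
  rw [mul_eq_one_iff_eq_inv, inv_simple] at h2
  rwa [hinj h2]

theorem mem_of_isRightDescent (hinj : Function.Injective cs.simple) {J : Set B} {u : W}
    (hu : u ∈ cs.parabolic J) {i : B} (h : cs.IsRightDescent u i) : i ∈ J := by
  have h1 := (cs.mul_simple_bruhatLE h).mem_parabolic hu
  refine cs.mem_of_simple_mem_parabolic hinj ?_
  simpa using mul_mem (inv_mem hu) h1

theorem mem_of_bruhatLE (hinj : Function.Injective cs.simple) {J : Set B} {u : W}
    (hu : u ∈ cs.parabolic J) {i : B} (h : cs.BruhatLE (cs.simple i) u) : i ∈ J :=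
  cs.mem_of_simple_mem_parabolic hinj (h.mem_parabolic hu)

theorem mem_parabolic_inter (hinj : Function.Injective cs.simple) {J K : Set B} {u : W}
    (hJ : u ∈ cs.parabolic J) (hK : u ∈ cs.parabolic K) : u ∈ cs.parabolic (J ∩ K) :=
  cs.parabolic_mono (K := J ∩ K)
    (fun _ hi => ⟨cs.mem_of_bruhatLE hinj hJ hi, cs.mem_of_bruhatLE hinj hK hi⟩)
    (cs.mem_parabolic_support u)

theorem mem_parabolic_singleton {i : B} {u : W} :
    u ∈ cs.parabolic {i} ↔ u = 1 ∨ u = cs.simple i := by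
  constructor
  · intro h
    induction h using Subgroup.closure_induction with
    | mem x hx => exact Or.inr (by simpa using hx)
    | one => exact Or.inl rfl
    | mul x y _ _ hx hy => rcases hx with rfl | rfl <;> rcases hy with rfl | rfl <;> simp
    | inv x _ hx => rcases hx with rfl | rfl <;> simp
  · rintro (rfl | rfl)
    · exact one_mem _
    · exact cs.simple_mem_parabolic rfl

/-- If `a ∈ W^J`, then left multiplication by a simple reflection either keeps `a` in `W^J` or
moves `a` inside its coset `a W_J` by a simple reflection of `J`. -/
theorem simple_mul_mem_minCosetReps_or {J : Set B} {a : W} (ha : a ∈ cs.minCosetReps J) (l : B) :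
    cs.simple l * a ∈ cs.minCosetReps J ∨ ∃ j ∈ J, cs.simple l * a = a * cs.simple j := by
  by_contra! h
  obtain ⟨h1, h2⟩ := h
  simp only [minCosetReps, Set.mem_ofPred_eq, not_forall, not_not] at h1
  obtain ⟨j, hj, hd⟩ := h1
  refine h2 j hj ?_
  have hup := cs.not_isRightDescent_iff.1 (ha j hj)
  obtain ⟨ω, hω, rfl⟩ := cs.exists_isReduced a
  have hd' := hd
  rw [IsRightDescent, ← wordProd_cons] at hd'
  obtain ⟨k, hk, he⟩ := cs.exists_eraseIdx_of_length_lt (cs.isReflection_simple j) _ hd'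
  -- Deleting the first letter `l` gives `l a = a j`; deleting any other letter would make `a j`
  -- shorter than `a`.
  rcases k with _ | k
  · rw [List.eraseIdx_cons_zero, wordProd_cons] at he
    nth_rw 2 [← he]
    simp
  · rw [List.eraseIdx_cons_succ, wordProd_cons, wordProd_cons, mul_assoc, mul_right_inj] at he
    rw [List.length_cons] at hk
    have := cs.length_wordProd_le (ω.eraseIdx k)
    rw [← he, List.length_eraseIdx_of_lt (by omega), hup, hω.eq] at this
    omega

/-! ### The maximum of `W_J ∩ [e, w]` -/

/-- Strip a right descent `r` of `w` and let `x` be the maximum for `wr`. If `r ∉ J`, no element of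
`W_J` has `r` as a descent and `x` still works; if `r ∈ J`, the larger of `x` and `xr` does. -/
theorem exists_isParabolicMax (hinj : Function.Injective cs.simple) (J : Set B) (w : W) :
    ∃ x, cs.IsParabolicMax J w x := by
  induction hn : cs.length w using Nat.strong_induction_on generalizing w with
  | _ n ih =>
    by_cases h1 : w = 1
    · subst h1
      exact ⟨1, ⟨one_mem _, cs.bruhatLE_refl _⟩, fun y _ hy => hy⟩
    obtain ⟨r, hr⟩ := cs.exists_rightDescent_of_ne_one h1
    obtain ⟨x, ⟨hxJ, hxw⟩, hmax⟩ := ih (cs.length (w * cs.simple r)) (hn ▸ hr) _ rfl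
    have hle := cs.mul_simple_bruhatLE hr
    by_cases hrJ : r ∈ J
    · by_cases hd : cs.IsRightDescent x r
      · refine ⟨x, ⟨hxJ, hxw.trans hle⟩, fun y hyJ hyw => ?_⟩
        by_cases hy : cs.IsRightDescent y r
        · have := hmax _ (mul_mem hyJ (cs.simple_mem_parabolic hrJ)) (hyw.mul_simple_mul_simple hy)
          simpa using this.mul_simple_of_isRightDescent hd
        · exact hmax y hyJ (hyw.of_not_isRightDescent hy)
      · refine ⟨x * cs.simple r, ⟨mul_mem hxJ (cs.simple_mem_parabolic hrJ),
          (hxw.trans hle).mul_simple_of_isRightDescent hr⟩, fun y hyJ hyw => ?_⟩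
        have hxd : cs.IsRightDescent (x * cs.simple r) r := by
          rw [isRightDescent_iff_not_isRightDescent_mul]
          simpa using hd
        have hxx := cs.bruhatLE_mul_simple hd
        by_cases hy : cs.IsRightDescent y r
        · have := hmax _ (mul_mem hyJ (cs.simple_mem_parabolic hrJ)) (hyw.mul_simple_mul_simple hy)
          simpa using (this.trans hxx).mul_simple_of_isRightDescent hxd
        · exact (hmax y hyJ (hyw.of_not_isRightDescent hy)).trans hxx
    · exact ⟨x, ⟨hxJ, hxw.trans hle⟩, fun y hyJ hyw => hmax y hyJ
        (hyw.of_not_isRightDescent fun hd => hrJ (cs.mem_of_isRightDescent hinj hyJ hd))⟩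

theorem isParabolicMax_parabolicMax (hinj : Function.Injective cs.simple) (J : Set B) (w : W) :
    cs.IsParabolicMax J w (cs.parabolicMax J w) :=
  Classical.epsilon_spec (cs.exists_isParabolicMax hinj J w)

variable {cs} in
theorem IsParabolicMax.eq {J : Set B} {w x y : W} (hx : cs.IsParabolicMax J w x)
    (hy : cs.IsParabolicMax J w y) : x = y :=
  (hy.2 x hx.1.1 hx.1.2).antisymm (hx.2 y hy.1.1 hy.1.2)

/-! ### Commutation lemmas -/

theorem not_isRightDescent_mul_of_commute {a : W} {i j : B} (ha : ¬ cs.IsRightDescent a i)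
    (hne : cs.simple i ≠ cs.simple j) (hc : Commute (cs.simple i) (cs.simple j)) :
    ¬ cs.IsRightDescent (a * cs.simple j) i := by
  have h1 : cs.BruhatEdge a (a * cs.simple i) := by
    refine ⟨by simpa using cs.isReflection_simple i, ?_⟩
    have := cs.not_isRightDescent_iff.1 ha
    omega
  have h2 := (h1.mul_simple j fun h => hne (mul_left_cancel h)).2
  rw [mul_assoc, hc.eq, ← mul_assoc] at h2
  rw [IsRightDescent]
  omega

theorem not_isLeftDescent_mul_of_commute {a : W} {i j : B} (ha : ¬ cs.IsLeftDescent a i)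
    (hne : cs.simple i ≠ cs.simple j) (hc : Commute (cs.simple i) (cs.simple j)) :
    ¬ cs.IsLeftDescent (cs.simple j * a) i := by
  rw [← isRightDescent_inv_iff, mul_inv_rev, inv_simple]
  exact cs.not_isRightDescent_mul_of_commute (by rwa [isRightDescent_inv_iff]) hne hc

/-- A simple reflection outside of the support of `a` which commutes with `a` commutes with the
right descents of `a`. -/
theorem commute_of_commute (hinj : Function.Injective cs.simple) {K : Set B} {a : W}
    (ha : a ∈ cs.parabolic K) {j t : B} (hj : j ∉ K) (hc : Commute a (cs.simple j))
    (ht : cs.IsRightDescent a t) : Commute (cs.simple j) (cs.simple t) := by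
  have htK : t ∈ K := cs.mem_of_isRightDescent hinj ha ht
  have htj : t ≠ j := fun h => hj (h ▸ htK)
  have hja : ¬ cs.IsRightDescent a j := fun h => hj (cs.mem_of_isRightDescent hinj ha h)
  have h1 := cs.not_isRightDescent_iff.1 hja
  have h2 := cs.isRightDescent_iff.1 ht
  have hjmem : j ∈ ({t, j} : Set B) := by simp
  have htmem : t ∈ ({t, j} : Set B) := by simp
  have hd1 : cs.IsRightDescent (a * cs.simple j) j := by
    rw [isRightDescent_iff_not_isRightDescent_mul]
    simpa using hja
  -- Since `a j t = j (a t)`, its length is at most `ℓ(a)`.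
  have hd2 : cs.IsRightDescent (a * cs.simple j) t := by
    have h3 := cs.length_mul_le (cs.simple j) (a * cs.simple t)
    rw [length_simple, ← mul_assoc, ← hc.eq] at h3
    rw [IsRightDescent]
    omega
  have hc' := cs.minRep_mem {t, j} (a * cs.simple j)
  have hd' := cs.parPart_mem {t, j} (a * cs.simple j)
  have hcd := cs.minRep_mul_parPart {t, j} (a * cs.simple j)
  set c := cs.minRep {t, j} (a * cs.simple j)
  set d := cs.parPart {t, j} (a * cs.simple j)
  rw [← hcd, cs.isRightDescent_mul_iff hc' hd' hjmem] at hd1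
  rw [← hcd, cs.isRightDescent_mul_iff hc' hd' htmem] at hd2
  have hdj : d * cs.simple j ∈ cs.parabolic {t, j} :=
    mul_mem hd' (cs.simple_mem_parabolic hjmem)
  have hacd : a = c * (d * cs.simple j) := by
    rw [← mul_assoc, hcd, mul_assoc, simple_mul_simple_self, mul_one]
  have hle : cs.BruhatLE (d * cs.simple j) a := by
    rw [hacd]
    exact cs.bruhatLE_mul_left (cs.length_mul_of_mem_minCosetReps hc' hdj)
  -- `d j` lies in `W_{t,j} ∩ W_K`, hence in `W_{t}`, so `d` is `j` or `t j`.
  have hmem := cs.mem_parabolic_inter hinj hdj (hle.mem_parabolic ha)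
  have hmem' : d * cs.simple j ∈ cs.parabolic {t} := by
    refine cs.parabolic_mono ?_ hmem
    rintro i ⟨hi | hi, hiK⟩
    · exact hi
    · exact absurd (hi ▸ hiK) hj
  have hne : ∀ x : W, x * cs.simple j = 1 → x = cs.simple j := fun x h => by
    rw [mul_eq_one_iff_eq_inv.1 h, inv_simple]
  rcases cs.mem_parabolic_singleton.1 hmem' with h | h
  · have hd : d = cs.simple j := hne d h
    rw [hd, IsRightDescent, length_simple] at hd2
    have h3 : cs.simple j * cs.simple t = 1 := by
      rw [← cs.length_eq_zero_iff]
      omega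
    rw [mul_eq_one_iff_eq_inv, inv_simple] at h3
    exact absurd (hinj h3.symm) htj
  · have hd : d = cs.simple t * cs.simple j := by
      rw [← h, mul_assoc, simple_mul_simple_self, mul_one]
    rw [hd, IsRightDescent] at hd2
    have h3 := cs.length_mul_le (cs.simple t) (cs.simple j)
    rw [length_simple, length_simple] at h3
    -- The reflection `t j t` has odd length less than `2`, so it is a simple reflection, and it can
    -- only be `j`.
    have hodd : Odd (cs.length (cs.simple t * cs.simple j * cs.simple t)) := by
      have := (cs.isReflection_simple j).conj (cs.simple t)
      rw [inv_simple] at this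
      exact this.odd_length
    have h4 : cs.length (cs.simple t * cs.simple j * cs.simple t) = 1 := by
      obtain ⟨k, hk⟩ := hodd
      omega
    obtain ⟨r, hr⟩ := cs.length_eq_one_iff.1 h4
    have hrmem : r ∈ ({t, j} : Set B) := by
      apply cs.mem_of_simple_mem_parabolic hinj
      rw [← hr]
      exact mul_mem (mul_mem (cs.simple_mem_parabolic htmem) (cs.simple_mem_parabolic hjmem))
        (cs.simple_mem_parabolic htmem)
    rcases hrmem with rfl | hrj
    · exfalso
      rw [mul_eq_right, mul_eq_one_iff_eq_inv, inv_simple] at hr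
      exact htj (hinj hr)
    · rw [Set.mem_singleton_iff.1 hrj, ← eq_mul_inv_iff_mul_eq, inv_simple] at hr
      exact hr.symm

/-- If `v ∈ W_{s,t}` conjugates the simple reflection `j` into a parabolic subgroup which does not
contain both `s` and `t`, then `j` and `t` commute. -/
theorem commute_of_conj_mem_parabolic (hinj : Function.Injective cs.simple) {s t j : B}
    {P : Set B} {v : W} (hv : v ∈ cs.parabolic {s, t}) (hP : ¬ (s ∈ P ∧ t ∈ P)) (hjs : j ≠ s)
    (hjt : j ≠ t) (hvs : ¬ cs.IsRightDescent v s) (hv1 : v ≠ 1) (hvt : v ≠ cs.simple t)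
    (hmem : v * cs.simple j * v⁻¹ ∈ cs.parabolic P) :
    Commute (cs.simple j) (cs.simple t) := by
  have h1 := cs.leftParPart_mem P v
  have h2 := cs.leftMinRep_not_isLeftDescent P v
  have h12 := cs.leftParPart_mul_leftMinRep P v
  set v₁ := cs.leftParPart P v
  set v₂ := cs.leftMinRep P v
  have hlen := cs.length_mul_of_not_isLeftDescent h1 h2
  have hle1 : cs.BruhatLE v₁ v := h12 ▸ cs.bruhatLE_mul_right hlen
  have hle2 : cs.BruhatLE v₂ v := h12 ▸ cs.bruhatLE_mul_left hlen
  have hv2 := hle2.mem_parabolic hv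
  -- If `v₂ = 1`, then `v` lies in `W_{s}` or `W_{t}`, and the hypotheses on `v` exclude all of
  -- their elements.
  have hne : v₂ ≠ 1 := by
    intro h
    rw [h, mul_one] at h12
    have h3 := cs.mem_parabolic_inter hinj hv (h12 ▸ h1)
    by_cases hs : s ∈ P
    · have h4 : v ∈ cs.parabolic {s} := by
        refine cs.parabolic_mono ?_ h3
        rintro i ⟨hi | hi, hiP⟩
        · exact hi
        · exact absurd ⟨hs, Set.mem_singleton_iff.1 hi ▸ hiP⟩ hP
      rcases cs.mem_parabolic_singleton.1 h4 with h5 | h5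
      · exact hv1 h5
      · rw [h5] at hvs
        exact hvs (by simp [IsRightDescent])
    · have h4 : v ∈ cs.parabolic {t} := by
        refine cs.parabolic_mono ?_ h3
        rintro i ⟨hi | hi, hiP⟩
        · exact absurd (hi ▸ hiP) hs
        · exact hi
      rcases cs.mem_parabolic_singleton.1 h4 with h5 | h5
      · exact hv1 h5
      · exact hvt h5
  obtain ⟨r, hr, hrd⟩ := cs.exists_isRightDescent_of_mem_parabolic hv2 hne
  have hrv : cs.IsRightDescent v r := by
    have h3 := cs.length_mul_le v₁ (v₂ * cs.simple r)
    rw [← mul_assoc, h12] at h3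
    rw [h12] at hlen
    rw [IsRightDescent] at hrd ⊢
    omega
  have hrt : r = t := by
    rcases hr with rfl | hr
    · exact absurd hrv hvs
    · exact hr
  subst hrt
  have hjst : j ∉ ({s, r} : Set B) := by simp [hjs, hjt]
  refine cs.commute_of_commute hinj hv2 hjst ?_ hrd
  have hmem2 : v₂ * cs.simple j * v₂⁻¹ ∈ cs.parabolic P := by
    have h3 := mul_mem (mul_mem (inv_mem h1) hmem) h1
    have h4 : v₁⁻¹ * (v * cs.simple j * v⁻¹) * v₁ = v₂ * cs.simple j * v₂⁻¹ := by
      rw [← h12]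
      group
    rwa [h4] at h3
  have ha : v₂⁻¹ ∈ cs.minCosetReps P := fun i hi => by
    rw [isRightDescent_inv_iff]
    exact h2 i hi
  -- In the first case `v₂⁻¹` and `j v₂⁻¹` would be two minimal representatives of one coset of
  -- `W_P`. In the second, comparing supports gives `q = j`, so `v₂` commutes with `j`.
  rcases cs.simple_mul_mem_minCosetReps_or ha j with h | ⟨q, hq, h⟩
  · exfalso
    have h3 := cs.eq_of_mem_minCosetReps ha h (by rwa [inv_inv, ← mul_assoc])
    rw [right_eq_mul] at h3
    have := cs.length_simple j
    rw [h3, length_one] at this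
    omega
  · have h3 : cs.simple j = v₂⁻¹ * cs.simple q * v₂ := by
      rw [← h, inv_mul_cancel_right]
    have hsub : ({s, r} : Set B) ⊆ {s, r, q} := by
      intro i hi
      rcases hi with rfl | hi
      · simp
      · simp [Set.mem_singleton_iff.1 hi]
    have h4 : j ∈ ({s, r, q} : Set B) := by
      apply cs.mem_of_simple_mem_parabolic hinj
      rw [h3]
      exact mul_mem (mul_mem (inv_mem (cs.parabolic_mono hsub hv2))
        (cs.simple_mem_parabolic (by simp))) (cs.parabolic_mono hsub hv2)
    have h5 : j = q := by simpa [hjs, hjt] using h4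
    subst h5
    have h6 : Commute (cs.simple j) v₂⁻¹ := h
    exact Commute.inv_left_iff.1 h6.symm

/-! ### The factorization attached to `J`, `s`, `t` -/

/-- The factorization `u = x · y₁ · y₂ · z` with `x y₁ = u^J`, `y₂ z = u_J`, `x = (u^J)^{s,t}` and
`y₂ = _{s}(u_J)`. -/
structure IsRightFactorization (J : Set B) (s t : B) (u x y₁ y₂ z : W) : Prop where
  eq : u = x * y₁ * (y₂ * z)
  x_mem : x ∈ cs.minCosetReps {s, t}
  y₁_mem : y₁ ∈ cs.parabolic {s, t}
  xy₁_mem : x * y₁ ∈ cs.minCosetReps J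
  y₂_mem : y₂ ∈ cs.parabolic {s}
  z_mem : z ∈ cs.parabolic J
  z_not : ∀ i ∈ ({s} : Set B), ¬ cs.IsLeftDescent z i

theorem parabolic_singleton_le {J : Set B} {s : B} (hs : s ∈ J) :
    cs.parabolic {s} ≤ cs.parabolic J :=
  cs.parabolic_mono (by simpa using hs)

theorem isRightFactorization_self {J : Set B} {s : B} (hs : s ∈ J) (t : B) (u : W) :
    cs.IsRightFactorization J s t u (cs.minRep {s, t} (cs.minRep J u))
      (cs.parPart {s, t} (cs.minRep J u)) (cs.leftParPart {s} (cs.parPart J u))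
      (cs.leftMinRep {s} (cs.parPart J u)) where
  eq := by rw [minRep_mul_parPart, leftParPart_mul_leftMinRep, minRep_mul_parPart]
  x_mem := cs.minRep_mem _ _
  y₁_mem := cs.parPart_mem _ _
  xy₁_mem := by
    rw [minRep_mul_parPart]
    exact cs.minRep_mem _ _
  y₂_mem := cs.leftParPart_mem _ _
  z_mem := by
    have h := mul_mem (inv_mem (cs.parabolic_singleton_le hs (cs.leftParPart_mem {s}
      (cs.parPart J u)))) (cs.parPart_mem J u)
    nth_rw 2 [← cs.leftParPart_mul_leftMinRep {s} (cs.parPart J u)] at h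
    rwa [inv_mul_cancel_left] at h
  z_not := cs.leftMinRep_not_isLeftDescent _ _

namespace IsRightFactorization

variable {cs} {J : Set B} {s t : B} {u x y₁ y₂ z : W}

theorem y₂z_mem (h : cs.IsRightFactorization J s t u x y₁ y₂ z) (hs : s ∈ J) :
    y₂ * z ∈ cs.parabolic J :=
  mul_mem (cs.parabolic_singleton_le hs h.y₂_mem) h.z_mem

theorem minRep_eq (h : cs.IsRightFactorization J s t u x y₁ y₂ z) (hs : s ∈ J) :
    cs.minRep J u = x * y₁ := by
  rw [h.eq, cs.minRep_mul h.xy₁_mem (h.y₂z_mem hs)]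

theorem minRep_minRep_eq (h : cs.IsRightFactorization J s t u x y₁ y₂ z) (hs : s ∈ J) :
    cs.minRep {s, t} (cs.minRep J u) = x := by
  rw [h.minRep_eq hs, cs.minRep_mul h.x_mem h.y₁_mem]

theorem rightAction_eq (h : cs.IsRightFactorization J s t u x y₁ y₂ z) (hs : s ∈ J)
    (Mst : W → W) : cs.rightAction J s t Mst u = x * Mst (y₁ * y₂) * z := by
  have h1 : cs.parPart J u = y₂ * z := by rw [h.eq, cs.parPart_mul h.xy₁_mem (h.y₂z_mem hs)]
  rw [rightAction, h.minRep_minRep_eq hs, h.minRep_eq hs, h1, cs.parPart_mul h.x_mem h.y₁_mem,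
    cs.leftParPart_mul h.z_not h.y₂_mem, cs.leftMinRep_mul h.z_not h.y₂_mem]

theorem length_eq (h : cs.IsRightFactorization J s t u x y₁ y₂ z) (hs : s ∈ J) :
    cs.length u = cs.length x + cs.length y₁ + cs.length y₂ + cs.length z := by
  rw [h.eq, cs.length_mul_of_mem_minCosetReps h.xy₁_mem (h.y₂z_mem hs),
    cs.length_mul_of_mem_minCosetReps h.x_mem h.y₁_mem,
    cs.length_mul_of_not_isLeftDescent h.y₂_mem h.z_not]
  ring

theorem y₁y₂_mem (h : cs.IsRightFactorization J s t u x y₁ y₂ z) :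
    y₁ * y₂ ∈ cs.parabolic {s, t} :=
  mul_mem h.y₁_mem (cs.parabolic_singleton_le (by simp) h.y₂_mem)

theorem y₁y₂_le (h : cs.IsRightFactorization J s t u x y₁ y₂ z) (hs : s ∈ J) :
    cs.BruhatLE (y₁ * y₂) u := by
  have h0 := h.length_eq hs
  have e : u = x * (y₁ * y₂ * z) := by rw [h.eq]; simp only [mul_assoc]
  have h1 := cs.length_mul_le y₁ y₂
  have h2 := cs.length_mul_le (y₁ * y₂) z
  have h3 := cs.length_mul_le x (y₁ * y₂ * z)
  rw [← e] at h3
  exact (cs.bruhatLE_mul_right (a := y₁ * y₂) (b := z) (by omega)).trans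
    (e ▸ cs.bruhatLE_mul_left (by rw [← e]; omega))

theorem y₁_le (h : cs.IsRightFactorization J s t u x y₁ y₂ z) (hs : s ∈ J) :
    cs.BruhatLE y₁ (y₁ * y₂) := by
  have h0 := h.length_eq hs
  have e : u = x * (y₁ * y₂ * z) := by rw [h.eq]; simp only [mul_assoc]
  have h1 := cs.length_mul_le y₁ y₂
  have h2 := cs.length_mul_le (y₁ * y₂) z
  have h3 := cs.length_mul_le x (y₁ * y₂ * z)
  rw [← e] at h3
  exact cs.bruhatLE_mul_right (by omega)

theorem not_isRightDescent_y₁ (h : cs.IsRightFactorization J s t u x y₁ y₂ z) (hs : s ∈ J) :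
    ¬ cs.IsRightDescent y₁ s := by
  rw [← cs.isRightDescent_mul_iff h.x_mem h.y₁_mem (by simp)]
  exact h.xy₁_mem s hs

theorem isLeftDescent (h : cs.IsRightFactorization J s t u x y₁ y₂ z) (hs : s ∈ J) {l : B}
    (hl : cs.IsLeftDescent x l) : cs.IsLeftDescent u l := by
  have h0 := h.length_eq hs
  have e : cs.simple l * u = cs.simple l * x * y₁ * (y₂ * z) := by
    rw [h.eq]; simp only [mul_assoc]
  have h1 := cs.length_mul_le y₂ z
  have h2 := cs.length_mul_le (cs.simple l * x * y₁) (y₂ * z)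
  have h3 := cs.length_mul_le (cs.simple l * x) y₁
  rw [IsLeftDescent] at hl ⊢
  rw [e]
  omega

/-- The factorization of `l u` when `l x = x p` with `p ∈ {s, t}`. -/
theorem simple_mul_of_eq (h : cs.IsRightFactorization J s t u x y₁ y₂ z)
    (hinj : Function.Injective cs.simple) (hs : s ∈ J) (ht : t ∉ J) {l p : B}
    (hp : p ∈ ({s, t} : Set B)) (hlp : cs.simple l * x = x * cs.simple p) :
    ∃ y₁' y₂', y₁' * y₂' = cs.simple p * (y₁ * y₂) ∧
      cs.IsRightFactorization J s t (cs.simple l * u) x y₁' y₂' z := by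
  -- Either `p` is absorbed by `y₁`, or it crosses `y₁` as a letter of `{s,t} ∩ J = {s}` and joins
  -- `y₂`.
  rcases cs.simple_mul_mem_minCosetReps_or h.xy₁_mem l with h1 | ⟨j, hj, h1⟩
  · refine ⟨cs.simple p * y₁, y₂, mul_assoc _ _ _, ⟨?_, h.x_mem,
      mul_mem (cs.simple_mem_parabolic hp) h.y₁_mem, ?_, h.y₂_mem, h.z_mem, h.z_not⟩⟩
    · rw [← mul_assoc x, ← hlp, h.eq]
      simp only [mul_assoc]
    · rwa [← mul_assoc x, ← hlp, mul_assoc]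
  · rw [← mul_assoc, hlp, mul_assoc, mul_assoc, mul_right_inj] at h1
    have hjmem : j ∈ ({s, t} : Set B) := by
      apply cs.mem_of_simple_mem_parabolic hinj
      have h2 := mul_mem (inv_mem h.y₁_mem) (mul_mem (cs.simple_mem_parabolic hp) h.y₁_mem)
      rwa [h1, inv_mul_cancel_left] at h2
    have hjs : j = s := by
      rcases hjmem with hj' | hj'
      · exact hj'
      · exact absurd (Set.mem_singleton_iff.1 hj' ▸ hj) ht
    subst hjs
    refine ⟨y₁, cs.simple j * y₂, by rw [← mul_assoc, ← h1, mul_assoc], ⟨?_, h.x_mem, h.y₁_mem,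
      h.xy₁_mem, mul_mem (cs.simple_mem_parabolic rfl) h.y₂_mem, h.z_mem, h.z_not⟩⟩
    rw [mul_assoc (cs.simple j), mul_assoc x, ← mul_assoc y₁, ← h1, mul_assoc (cs.simple p),
      ← mul_assoc x, ← hlp, h.eq]
    simp only [mul_assoc]

end IsRightFactorization

theorem simple_ne_one (i : B) : cs.simple i ≠ 1 := by
  intro h
  have := cs.length_simple i
  rw [h, length_one] at this
  omega

theorem isLeftDescent_of_bruhatLE {w : W} {i : B} (h : cs.BruhatLE (cs.simple i * w) w) :
    cs.IsLeftDescent w i :=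
  lt_of_le_of_ne h.length_le (cs.length_simple_mul_ne w i)

/-! ### Commutation with left descents of `(w^J)^{s,t}` -/

namespace IsRightSystem

variable {cs} {w : W} {J : Set B} {s t : B} {Mst : W → W}

theorem le_parabolicMax (hinj : Function.Injective cs.simple) {u : W}
    (hu : cs.BruhatLE u w) (hmem : u ∈ cs.parabolic {s, t}) :
    cs.BruhatLE u (cs.parabolicMax {s, t} w) :=
  (cs.isParabolicMax_parabolicMax hinj {s, t} w).2 u hmem hu

/-- An involution sending `y₁` to `y₁ s` sends `y₁ s` back, so agreement with `ρ_s` at `y₁` passes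
to `y₁ s`. -/
theorem mul_y₂ (h : cs.IsRightSystem w J s t Mst) {y₁ y₂ : W}
    (hy₁ : cs.BruhatLE y₁ (cs.parabolicMax {s, t} w)) (hM : Mst y₁ = y₁ * cs.simple s)
    (hy₂ : y₂ ∈ cs.parabolic {s}) : Mst (y₁ * y₂) = y₁ * y₂ * cs.simple s := by
  rcases cs.mem_parabolic_singleton.1 hy₂ with rfl | rfl
  · simpa using hM
  · rw [← hM, h.special.involutive _ hy₁, hM]
    simp

/-- Since `p = x⁻¹ l x`, the letter `p` is in the support of `(w^J)^{s,t}`; condition 4 then makes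
`M_st` commute with `λ_p`. -/
theorem map_simple_mul (h : cs.IsRightSystem w J s t Mst) (hinj : Function.Injective cs.simple)
    {x : W} (hx : cs.BruhatLE x (cs.minRep {s, t} (cs.minRep J w))) {l p : B}
    (hl : cs.BruhatLE (cs.simple l) (cs.minRep {s, t} (cs.minRep J w)))
    (hp : p ∈ ({s, t} : Set B)) (hlp : cs.simple l * x = x * cs.simple p) {y : W}
    (hy : cs.BruhatLE y (cs.parabolicMax {s, t} w))
    (hpy : cs.BruhatLE (cs.simple p * y) (cs.parabolicMax {s, t} w)) :
    Mst (cs.simple p * y) = cs.simple p * Mst y := by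
  set x₀ := cs.minRep {s, t} (cs.minRep J w)
  have hx₀ := hx.mem_parabolic (cs.mem_parabolic_support x₀)
  have hpx : cs.BruhatLE (cs.simple p) x₀ := by
    apply cs.mem_of_simple_mem_parabolic (J := {i | cs.BruhatLE (cs.simple i) x₀}) hinj
    have h1 := mul_mem (inv_mem hx₀) (mul_mem (cs.simple_mem_parabolic
      (J := {i | cs.BruhatLE (cs.simple i) x₀}) hl) hx₀)
    rwa [hlp, inv_mul_cancel_left] at h1
  by_cases hsx : cs.BruhatLE (cs.simple s) x₀
  · by_cases htx : cs.BruhatLE (cs.simple t) x₀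
    · rw [h.both_le hsx htx _ hpy, h.both_le hsx htx _ hy, mul_assoc]
    · rcases hp with rfl | hp
      · exact h.s_le hsx htx y hy
      · exact absurd (Set.mem_singleton_iff.1 hp ▸ hpx) htx
  · rcases hp with rfl | hp
    · exact absurd hpx hsx
    · have hpt := Set.mem_singleton_iff.1 hp
      subst hpt
      exact h.t_le hsx hpx y hy

theorem mem_parabolic_map (h : cs.IsRightSystem w J s t Mst)
    (hinj : Function.Injective cs.simple) {y : W}
    (hy : cs.BruhatLE y (cs.parabolicMax {s, t} w)) : Mst y ∈ cs.parabolic {s, t} :=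
  (h.special.mapsTo y hy).mem_parabolic (cs.isParabolicMax_parabolicMax hinj {s, t} w).1.1

/-- If `l` is a left descent of `(w^J)^{s,t}`, then the right system action commutes with left
multiplication by `l`. -/
theorem rightAction_simple_mul (h : cs.IsRightSystem w J s t Mst)
    (hinj : Function.Injective cs.simple) {l : B}
    (hl : cs.IsLeftDescent (cs.minRep {s, t} (cs.minRep J w)) l) {u : W}
    (hu : cs.BruhatLE u w) :
    cs.rightAction J s t Mst (cs.simple l * u) = cs.simple l * cs.rightAction J s t Mst u := by
  have hs := h.s_mem
  have ht := h.t_notMem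
  have hlu : cs.BruhatLE (cs.simple l * u) w := hu.simple_mul_of_isLeftDescent
    ((cs.isRightFactorization_self hs t w).isLeftDescent hs hl)
  have hF := cs.isRightFactorization_self hs t u
  have hx := (hu.minRep J).minRep {s, t}
  have hxyJ := hu.minRep J
  rw [hF.minRep_eq hs] at hxyJ
  have hlx₀ := cs.simple_bruhatLE_of_isLeftDescent hl
  set x := cs.minRep {s, t} (cs.minRep J u)
  set y₁ := cs.parPart {s, t} (cs.minRep J u)
  set y₂ := cs.leftParPart {s} (cs.parPart J u)
  set z := cs.leftMinRep {s} (cs.parPart J u)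
  have hy₁ := hF.y₁_mem
  have hyle := (hF.y₁y₂_le hs).trans hu
  have hy : cs.BruhatLE (y₁ * y₂) (cs.parabolicMax {s, t} w) :=
    le_parabolicMax hinj hyle hF.y₁y₂_mem
  have hy₁w : cs.BruhatLE y₁ (cs.parabolicMax {s, t} w) := (hF.y₁_le hs).trans hy
  rw [hF.rightAction_eq hs]
  rcases cs.simple_mul_mem_minCosetReps_or hF.x_mem l with hlx | ⟨p, hp, hlp⟩
  · rcases cs.simple_mul_mem_minCosetReps_or hF.xy₁_mem l with hlxy | ⟨j, hj, hlj⟩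
    · have hF' : cs.IsRightFactorization J s t (cs.simple l * u) (cs.simple l * x) y₁ y₂ z :=
        ⟨by rw [hF.eq]; simp only [mul_assoc], hlx, hy₁, by rwa [mul_assoc], hF.y₂_mem, hF.z_mem,
          hF.z_not⟩
      rw [hF'.rightAction_eq hs]
      simp only [mul_assoc]
    · have hconj : cs.simple l * x = x * (y₁ * cs.simple j * y₁⁻¹) := by
        rw [← mul_assoc, ← mul_assoc, ← hlj]
        group
      -- Otherwise `x` and `l x` would be two minimal representatives of the same `W_{s,t}`-coset.
      have hjst : j ∉ ({s, t} : Set B) := by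
        intro hj'
        have h1 := cs.eq_of_mem_minCosetReps hF.x_mem hlx (by
          rw [hconj, inv_mul_cancel_left]
          exact mul_mem (mul_mem hy₁ (cs.simple_mem_parabolic hj')) (inv_mem hy₁))
        rw [right_eq_mul] at h1
        exact cs.simple_ne_one l h1
      have hjs : j ≠ s := fun h => hjst (by simp [h])
      have hjt : j ≠ t := fun h => hjst (by simp [h])
      have hx₀ := hx.mem_parabolic (cs.mem_parabolic_support _)
      -- As `j` is conjugate to `l` by `x y₁`, it is `l` or lies in the support of `x y₁`; both are
      -- below `w^J`.
      have hjw : cs.BruhatLE (cs.simple j) (cs.minRep J w) := by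
        by_cases hjl : j = l
        · rw [hjl]
          refine hlx₀.trans ?_
          nth_rw 2 [← cs.minRep_mul_parPart {s, t} (cs.minRep J w)]
          exact cs.bruhatLE_mul_right
            (cs.length_mul_of_mem_minCosetReps (cs.minRep_mem _ _) (cs.parPart_mem _ _))
        · refine BruhatLE.trans ?_ hxyJ
          have h1 := cs.mem_parabolic_support (x * y₁)
          have h2 : ∀ K : Set B, x * y₁ ∈ cs.parabolic K → l ∈ K → j ∈ K := by
            intro K hK hlK
            apply cs.mem_of_simple_mem_parabolic hinj
            have h3 := mul_mem (inv_mem hK) (mul_mem (cs.simple_mem_parabolic hlK) hK)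
            rwa [hlj, inv_mul_cancel_left] at h3
          have h3 := h2 (insert l {i | cs.BruhatLE (cs.simple i) (x * y₁)})
            (cs.parabolic_mono (Set.subset_insert _ _) h1) (Set.mem_insert _ _)
          exact h3.resolve_left hjl
      have hcomm : Commute (cs.simple j) (cs.simple s) := h.comm_s j hj hjw
      have hcy₂ : Commute (cs.simple j) y₂ := by
        rcases cs.mem_parabolic_singleton.1 hF.y₂_mem with h1 | h1
        · rw [h1]; exact Commute.one_right _
        · rw [h1]; exact hcomm
      have hF' : cs.IsRightFactorization J s t (cs.simple l * u) x y₁ y₂ (cs.simple j * z) := by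
        refine ⟨?_, hF.x_mem, hy₁, hF.xy₁_mem, hF.y₂_mem,
          mul_mem (cs.simple_mem_parabolic hj) hF.z_mem, ?_⟩
        · rw [← mul_assoc y₂, ← hcy₂.eq, mul_assoc (cs.simple j), ← mul_assoc (x * y₁), ← hlj,
            mul_assoc, ← hF.eq]
        · rintro i rfl
          exact cs.not_isLeftDescent_mul_of_commute (hF.z_not _ rfl)
            (fun h => hjs (hinj h).symm) hcomm.symm
      rw [hF'.rightAction_eq hs]
      -- Wherever `M_st` acts as `ρ_s` this element is `y₂ s`, which commutes with `j`. That settles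
      -- the cases `s, t ≤ (w^J)^{s,t}`, `y₁ = 1` and `y₁ = t`.
      suffices hc : Commute (cs.simple j) (y₁⁻¹ * Mst (y₁ * y₂)) by
        have e1 : x * Mst (y₁ * y₂) * (cs.simple j * z) =
            x * y₁ * (y₁⁻¹ * Mst (y₁ * y₂) * cs.simple j) * z := by group
        rw [e1, ← hc.eq, ← mul_assoc (x * y₁), ← hlj]
        group
      have hρ : Mst (y₁ * y₂) = y₁ * y₂ * cs.simple s →
          Commute (cs.simple j) (y₁⁻¹ * Mst (y₁ * y₂)) := by
        intro h1
        rw [h1, mul_assoc, inv_mul_cancel_left]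
        exact hcy₂.mul_right hcomm
      by_cases hboth : cs.BruhatLE (cs.simple s) (cs.minRep {s, t} (cs.minRep J w)) ∧
          cs.BruhatLE (cs.simple t) (cs.minRep {s, t} (cs.minRep J w))
      · exact hρ (h.both_le hboth.1 hboth.2 _ hy)
      by_cases hy1 : y₁ = 1
      · exact hρ (h.mul_y₂ hy₁w (by rw [hy1, h.map_one, one_mul]) hF.y₂_mem)
      by_cases hyt : y₁ = cs.simple t
      · exact hρ (h.mul_y₂ hy₁w (by rw [hyt] at hy₁w ⊢; exact h.map_t hy₁w) hF.y₂_mem)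
      -- Here `y₁ j y₁⁻¹ = x⁻¹ l x` lies in the parabolic subgroup on the support of `(w^J)^{s,t}`,
      -- which misses `s` or `t`.
      have hct : Commute (cs.simple j) (cs.simple t) := by
        refine cs.commute_of_conj_mem_parabolic hinj
          (P := {i | cs.BruhatLE (cs.simple i) (cs.minRep {s, t} (cs.minRep J w))})
          hy₁ hboth hjs hjt (hF.not_isRightDescent_y₁ hs) hy1 hyt ?_
        have h1 := mul_mem (inv_mem hx₀) (mul_mem (cs.simple_mem_parabolic
          (J := {i | cs.BruhatLE (cs.simple i) (cs.minRep {s, t} (cs.minRep J w))}) hlx₀) hx₀)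
        rwa [hconj, inv_mul_cancel_left] at h1
      have hcst : ∀ y ∈ cs.parabolic {s, t}, Commute (cs.simple j) y := by
        intro y hy
        have : cs.parabolic {s, t} ≤ Subgroup.centralizer {cs.simple j} := by
          refine (Subgroup.closure_le _).2 ?_
          rintro _ ⟨i, hi, rfl⟩
          rw [SetLike.mem_coe, Subgroup.mem_centralizer_singleton_iff]
          rcases hi with rfl | hi
          · exact hcomm.eq.symm
          · rw [Set.mem_singleton_iff.1 hi]
            exact hct.eq.symm
        exact (Subgroup.mem_centralizer_singleton_iff.1 (this hy)).symm
      exact hcst _ (mul_mem (inv_mem hy₁) (h.mem_parabolic_map hinj hy))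
  · obtain ⟨y₁', y₂', he, hF'⟩ := hF.simple_mul_of_eq hinj hs ht hp hlp
    rw [hF'.rightAction_eq hs, he, h.map_simple_mul hinj hx hlx₀ hp hlp hy, ← mul_assoc, ← hlp]
    · simp only [mul_assoc]
    · rw [← he]
      exact le_parabolicMax hinj ((hF'.y₁y₂_le hs).trans hlu) hF'.y₁y₂_mem

end IsRightSystem

/-! ### Dihedral parabolic subgroups of doubly laced Coxeter systems -/

theorem braid_of_eq_four {s t : B} (h : C s t = 4) :
    cs.simple s * cs.simple t * cs.simple s * cs.simple t =
      cs.simple t * cs.simple s * cs.simple t * cs.simple s := by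
  have hrel := cs.simple_mul_simple_pow s t
  rw [h, pow_succ, pow_succ, pow_two] at hrel
  have h6 := mul_eq_one_iff_eq_inv.1 ((mul_assoc _ _ _).symm.trans hrel)
  simp only [mul_inv_rev, inv_simple] at h6
  simpa only [mul_assoc] using h6

theorem braid_of_eq_three {s t : B} (h : C s t = 3) :
    cs.simple s * cs.simple t * cs.simple s = cs.simple t * cs.simple s * cs.simple t := by
  have hrel := cs.simple_mul_simple_pow s t
  rw [h, pow_succ, pow_two] at hrel
  have h1 : cs.simple s * cs.simple t * cs.simple s *
      (cs.simple t * cs.simple s * cs.simple t) = 1 := by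
    rw [← hrel]
    simp only [mul_assoc]
  have h6 := mul_eq_one_iff_eq_inv.1 h1
  simp only [mul_inv_rev, inv_simple] at h6
  simpa only [mul_assoc] using h6

theorem braid_of_eq_two {s t : B} (h : C s t = 2) :
    cs.simple s * cs.simple t = cs.simple t * cs.simple s := by
  have hrel := cs.simple_mul_simple_pow s t
  rw [h, pow_two] at hrel
  have h6 := mul_eq_one_iff_eq_inv.1 hrel
  simpa only [mul_inv_rev, inv_simple] using h6

/-- Letters stripped from the right alternate `t, s, t, s`. A fourth one would give a
length-additive `y = d s t s t`; the relations for `m = 2, 3` shorten it, and that for `m = 4` makes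
`s` a right descent. -/
theorem eq_or_of_not_isRightDescent (hdl : cs.IsDoublyLaced) {s t : B} (hst : s ≠ t) {y : W}
    (hy : y ∈ cs.parabolic {s, t}) (hys : ¬ cs.IsRightDescent y s) :
    y = 1 ∨ y = cs.simple t ∨ y = cs.simple s * cs.simple t ∨
      y = cs.simple t * cs.simple s * cs.simple t := by
  have hs' : s ∈ ({s, t} : Set B) := by simp
  have ht' : t ∈ ({s, t} : Set B) := by simp
  have step : ∀ {i j : B} {a : W}, ({i, j} : Set B) = {s, t} → a ∈ cs.parabolic {s, t} → a ≠ 1 →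
      ¬ cs.IsRightDescent a i → ∃ b ∈ cs.parabolic {s, t}, a = b * cs.simple j ∧
        cs.length a = cs.length b + 1 ∧ ¬ cs.IsRightDescent b j := by
    intro i j a hij ha hne hai
    obtain ⟨r, hr, hd⟩ := cs.exists_isRightDescent_of_mem_parabolic ha hne
    have hrj : r = j := by
      rw [← hij] at hr
      rcases hr with rfl | hr
      · exact absurd hd hai
      · exact hr
    subst hrj
    have h1 := cs.isRightDescent_iff.1 hd
    exact ⟨a * cs.simple r, mul_mem ha (cs.simple_mem_parabolic hr), by simp, h1.symm,
      cs.isRightDescent_iff_not_isRightDescent_mul.1 hd⟩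
  by_cases h1 : y = 1
  · exact Or.inl h1
  right
  obtain ⟨a, ha, rfl, la, hat⟩ := step rfl hy h1 hys
  by_cases h1 : a = 1
  · exact Or.inl (by simp [h1])
  right
  obtain ⟨b, hb, rfl, lb, hbs⟩ := step (Set.pair_comm t s) ha h1 hat
  by_cases h1 : b = 1
  · exact Or.inl (by simp [h1])
  right
  obtain ⟨c, hc, rfl, lc, hct⟩ := step rfl hb h1 hbs
  by_cases h1 : c = 1
  · simp [h1]
  exfalso
  obtain ⟨d, hd, rfl, ld, -⟩ := step (Set.pair_comm t s) hc h1 hct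
  obtain ⟨h0, h4⟩ := hdl s t
  rcases (by omega : C s t = 1 ∨ C s t = 2 ∨ C s t = 3 ∨ C s t = 4) with h | h | h | h
  · exact C.off_diagonal s t hst h
  · have e : d * cs.simple s * cs.simple t * cs.simple s * cs.simple t = d := by
      rw [mul_assoc d, cs.braid_of_eq_two h]
      simp [mul_assoc]
    rw [e] at la
    omega
  · have e : d * cs.simple s * cs.simple t * cs.simple s * cs.simple t =
        d * cs.simple t * cs.simple s := by
      have : d * cs.simple s * cs.simple t * cs.simple s =
          d * (cs.simple s * cs.simple t * cs.simple s) := by simp only [mul_assoc]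
      rw [this, cs.braid_of_eq_three h]
      simp [mul_assoc]
    rw [e] at la
    have h5 := cs.length_mul_le (d * cs.simple t) (cs.simple s)
    have h6 := cs.length_mul_le d (cs.simple t)
    rw [length_simple] at h5 h6
    omega
  · apply hys
    have h5 := cs.braid_of_eq_four h
    have e : d * cs.simple s * cs.simple t * cs.simple s * cs.simple t * cs.simple s =
        d * cs.simple t * cs.simple s * cs.simple t := by
      have : d * cs.simple s * cs.simple t * cs.simple s * cs.simple t =
          d * (cs.simple s * cs.simple t * cs.simple s * cs.simple t) := by
        simp only [mul_assoc]
      rw [this, h5]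
      simp [mul_assoc]
    rw [IsRightDescent, e]
    have h6 := cs.length_mul_le (d * cs.simple t * cs.simple s) (cs.simple t)
    have h7 := cs.length_mul_le (d * cs.simple t) (cs.simple s)
    have h8 := cs.length_mul_le d (cs.simple t)
    rw [length_simple] at h6 h7 h8
    omega

theorem exists_eq_mul_of_mem_pair {s t : B} {y : W} (hy : y ∈ cs.parabolic {s, t}) :
    ∃ a ∈ cs.parabolic {s, t}, ¬ cs.IsRightDescent a s ∧ cs.BruhatLE a y ∧
      (y = a ∨ y = a * cs.simple s) := by
  by_cases h : cs.IsRightDescent y s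
  · exact ⟨y * cs.simple s, mul_mem hy (cs.simple_mem_parabolic (by simp)),
      cs.isRightDescent_iff_not_isRightDescent_mul.1 h, cs.mul_simple_bruhatLE h,
      Or.inr (by simp)⟩
  · exact ⟨y, hy, h, cs.bruhatLE_refl y, Or.inl rfl⟩

theorem length_simple_mul_simple {s t : B} (h : cs.simple s ≠ cs.simple t) :
    cs.length (cs.simple s * cs.simple t) = 2 := by
  have h1 := cs.length_simple_mul (cs.simple t) s
  rw [length_simple] at h1
  rcases h1 with h1 | h1
  · exact h1
  · exfalso
    have h2 : cs.simple s * cs.simple t = 1 := by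
      rw [← cs.length_eq_zero_iff]
      omega
    rw [mul_eq_one_iff_eq_inv, inv_simple] at h2
    exact h h2

theorem mem_minCosetReps_of_mem_pair (hinj : Function.Injective cs.simple) {J : Set B} {s t : B}
    (ht : t ∉ J) {a : W} (ha : a ∈ cs.parabolic {s, t}) (has : ¬ cs.IsRightDescent a s) :
    a ∈ cs.minCosetReps J := by
  intro j hj hd
  rcases cs.mem_of_isRightDescent hinj ha hd with rfl | h
  · exact has hd
  · exact ht (Set.mem_singleton_iff.1 h ▸ hj)

theorem minRep_of_mem {J : Set B} {a : W} (ha : a ∈ cs.minCosetReps J) : cs.minRep J a = a := by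
  simpa using cs.minRep_mul ha (one_mem _)

/-! ### The dihedral case `(w^J)^{s,t} = 1` -/

namespace IsRightSystem

variable {cs} {w : W} {J : Set B} {s t : B} {Mst M : W → W}

/-- As `t ∉ J`, an `a ∈ W_{s,t}` without right descent `s` is in `W^J`, and `u ↦ u^J` is monotone.
Thus `M_st` need only be compared with `ρ_s` at such `a ≤ w^J`. -/
theorem exists_eq_mul_of_le (h : cs.IsRightSystem w J s t Mst)
    (hinj : Function.Injective cs.simple) {y : W}
    (hy : cs.BruhatLE y (cs.parabolicMax {s, t} w)) :
    ∃ a ∈ cs.parabolic {s, t}, ¬ cs.IsRightDescent a s ∧ cs.BruhatLE a (cs.minRep J w) ∧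
      (y = a ∨ y = a * cs.simple s) := by
  have hmax := (cs.isParabolicMax_parabolicMax hinj {s, t} w).1
  obtain ⟨a, ha, has, hay, he⟩ := cs.exists_eq_mul_of_mem_pair (hy.mem_parabolic hmax.1)
  refine ⟨a, ha, has, ?_, he⟩
  have h1 := (hay.trans (hy.trans hmax.2)).minRep J
  rwa [cs.minRep_of_mem (cs.mem_minCosetReps_of_mem_pair hinj h.t_notMem ha has)] at h1

theorem minRep_minRep_eq_one (hx : cs.minRep {s, t} (cs.minRep J w) = 1) {u : W}
    (hu : cs.BruhatLE u w) : cs.minRep {s, t} (cs.minRep J u) = 1 := by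
  have h1 := (hu.minRep J).minRep {s, t}
  rw [hx] at h1
  exact h1.eq_of_length_le (by simp)

/-- If `w ∈ W_{s,t} W_J` and `M_st = ρ_s`, then left multiplication by a left descent of `w^J`
lying in `{s, t}` commutes with `M`. -/
theorem exists_commuting (h : cs.IsRightSystem w J s t Mst)
    (hinj : Function.Injective cs.simple)
    (hM : ∀ u, cs.BruhatLE u w → M u = cs.rightAction J s t Mst u)
    {y₁ y₂ z : W} (hF : cs.IsRightFactorization J s t w 1 y₁ y₂ z)
    {l : B} (hl : l ∈ ({s, t} : Set B)) (hd : cs.IsLeftDescent y₁ l)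
    (hρ : ∀ u, cs.BruhatLE u (cs.parabolicMax {s, t} w) → Mst u = u * cs.simple s) :
    ∃ L : W → W, cs.IsLeftMultMatching w L ∧ CommuteOn {u | cs.BruhatLE u w} L M ∧
      L w ≠ M w := by
  have hs := h.s_mem
  have hx := hF.minRep_minRep_eq hs
  have hlw : cs.IsLeftDescent w l := by
    have h0 := hF.length_eq hs
    have e : cs.simple l * w = cs.simple l * y₁ * (y₂ * z) := by
      nth_rw 1 [hF.eq]
      simp only [mul_assoc, one_mul]
    have h1 := cs.length_mul_le (cs.simple l * y₁) (y₂ * z)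
    have h2 := cs.length_mul_le y₂ z
    rw [IsLeftDescent] at hd ⊢
    rw [e]
    omega
  refine ⟨fun u => cs.simple l * u, ⟨l, hlw, fun _ _ => rfl⟩, ?_, ?_⟩
  · intro u hu
    have hlu : cs.BruhatLE (cs.simple l * u) w := hu.simple_mul_of_isLeftDescent hlw
    show cs.simple l * M u = M (cs.simple l * u)
    rw [hM u hu, hM _ hlu]
    have hF' := cs.isRightFactorization_self hs t u
    rw [minRep_minRep_eq_one hx hu] at hF'
    obtain ⟨a, b, he, hF''⟩ := hF'.simple_mul_of_eq hinj hs h.t_notMem hl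
      (l := l) (by simp)
    rw [hF'.rightAction_eq hs, hF''.rightAction_eq hs,
      hρ _ (le_parabolicMax hinj ((hF'.y₁y₂_le hs).trans hu) hF'.y₁y₂_mem),
      hρ _ (le_parabolicMax hinj ((hF''.y₁y₂_le hs).trans hlu) hF''.y₁y₂_mem), he]
    simp only [one_mul, mul_assoc]
  · show cs.simple l * w ≠ M w
    rw [hM w (cs.bruhatLE_refl w), hF.rightAction_eq hs,
      hρ _ (le_parabolicMax hinj (hF.y₁y₂_le hs) hF.y₁y₂_mem)]
    -- Equality would cancel down to `l y₁ = y₁ s`, but `l` shortens `y₁` and `s` lengthens it.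
    intro he
    have hy₂ : y₂ * cs.simple s = cs.simple s * y₂ := by
      rcases cs.mem_parabolic_singleton.1 hF.y₂_mem with h1 | h1 <;> rw [h1]
      simp
    have e : cs.simple l * y₁ * (y₂ * z) = y₁ * cs.simple s * (y₂ * z) := by
      nth_rw 1 [hF.eq] at he
      calc _ = cs.simple l * (1 * y₁ * (y₂ * z)) := by simp only [mul_assoc, one_mul]
        _ = _ := he
        _ = y₁ * (y₂ * cs.simple s) * z := by simp only [mul_assoc, one_mul]
        _ = _ := by rw [hy₂]; simp only [mul_assoc]
    rw [mul_left_inj] at e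
    have h1 := cs.not_isRightDescent_iff.1 (hF.not_isRightDescent_y₁ hs)
    rw [IsLeftDescent, e] at hd
    omega

theorem map_ne (h : cs.IsRightSystem w J s t Mst) {a y : W}
    (ha : cs.BruhatLE a (cs.parabolicMax {s, t} w))
    (hy : cs.BruhatLE y (cs.parabolicMax {s, t} w)) (hMa : Mst a = a * cs.simple s)
    (hne : y ≠ a) (hne' : y ≠ a * cs.simple s) : ¬ (Mst y = a ∨ Mst y = a * cs.simple s) := by
  have h1 := h.special.involutive y hy
  rintro (he | he)
  · rw [he, hMa] at h1
    exact hne' h1.symm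
  · rw [he, ← hMa, h.special.involutive a ha] at h1
    exact hne h1.symm

theorem map_ne_self (h : cs.IsRightSystem w J s t Mst) {y : W}
    (hy : cs.BruhatLE y (cs.parabolicMax {s, t} w)) : Mst y ≠ y := by
  intro he
  rcases h.special.edge y hy with h1 | h1
  · exact h1.2.1 he.symm
  · exact h1.2.1 he

theorem map_eq_mul (h : cs.IsRightSystem w J s t Mst) (hinj : Function.Injective cs.simple)
    (hρ : ∀ a ∈ cs.parabolic {s, t}, ¬ cs.IsRightDescent a s → cs.BruhatLE a (cs.minRep J w) →
      cs.BruhatLE a (cs.parabolicMax {s, t} w) → Mst a = a * cs.simple s) (u : W)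
    (hu : cs.BruhatLE u (cs.parabolicMax {s, t} w)) : Mst u = u * cs.simple s := by
  obtain ⟨a, ha, has, haw, rfl | rfl⟩ := h.exists_eq_mul_of_le hinj hu
  · exact hρ _ ha has haw hu
  · have hau := (cs.bruhatLE_mul_simple has).trans hu
    exact h.mul_y₂ hau (hρ _ ha has haw hau) (cs.simple_mem_parabolic rfl)

end IsRightSystem

/-! ### Special matchings associated with right systems -/

theorem eq_one_or_eq_simple_of_length_le_one (hinj : Function.Injective cs.simple) {s t : B}
    {a : W} (ha : a ∈ cs.parabolic {s, t}) (has : ¬ cs.IsRightDescent a s)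
    (hl : cs.length a ≤ 1) : a = 1 ∨ a = cs.simple t := by
  rcases Nat.le_one_iff_eq_zero_or_eq_one.1 hl with h | h
  · exact Or.inl (cs.length_eq_zero_iff.1 h)
  · right
    obtain ⟨r, rfl⟩ := cs.length_eq_one_iff.1 h
    rcases cs.mem_of_simple_mem_parabolic hinj ha with rfl | hr
    · exact absurd (by simp [IsRightDescent]) has
    · rw [Set.mem_singleton_iff.1 hr]

namespace IsRightSystem

variable {cs} {w : W} {J : Set B} {s t : B} {Mst M : W → W}

theorem map_eq_mul_of_length_le_one (h : cs.IsRightSystem w J s t Mst)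
    (hinj : Function.Injective cs.simple) {a : W} (ha : a ∈ cs.parabolic {s, t})
    (has : ¬ cs.IsRightDescent a s) (hle : cs.BruhatLE a (cs.parabolicMax {s, t} w))
    (hl : cs.length a ≤ 1) : Mst a = a * cs.simple s := by
  rcases cs.eq_one_or_eq_simple_of_length_le_one hinj ha has hl with rfl | rfl
  · rw [h.map_one, one_mul]
  · exact h.map_t hle

/-- The image is `a` or `a s` with `a ≤ st`. The pairs `{1, s}` and `{t, ts}` are already matched,
so only `sts` remains. -/
theorem map_simple_mul_simple (h : cs.IsRightSystem w J s t Mst)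
    (hinj : Function.Injective cs.simple)
    (hy₁ : cs.minRep J w = cs.simple s * cs.simple t)
    (hle : cs.BruhatLE (cs.simple s * cs.simple t) (cs.parabolicMax {s, t} w)) :
    Mst (cs.simple s * cs.simple t) = cs.simple s * cs.simple t * cs.simple s := by
  have hst : cs.simple s ≠ cs.simple t := fun he => h.t_notMem (hinj he ▸ h.s_mem)
  have hl2 := cs.length_simple_mul_simple hst
  have hl1 := cs.length_simple s
  have hl1' := cs.length_simple t
  have hd := cs.minRep_mem J w s h.s_mem
  rw [hy₁, not_isRightDescent_iff] at hd
  have hT : cs.BruhatLE (cs.simple t) (cs.parabolicMax {s, t} w) :=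
    (cs.bruhatLE_mul_left (by rw [hl2, hl1, hl1'])).trans hle
  obtain ⟨a, ha, has, haw, hv⟩ := h.exists_eq_mul_of_le hinj (h.special.mapsTo _ hle)
  rw [hy₁] at haw
  by_cases hal : cs.length a ≤ 1
  · exfalso
    rcases cs.eq_one_or_eq_simple_of_length_le_one hinj ha has hal with rfl | rfl
    · refine h.map_ne (cs.one_bruhatLE _) hle (by rw [h.map_one, one_mul]) ?_ ?_ hv
      · intro e
        rw [e, length_one] at hl2
        omega
      · intro e
        rw [e, one_mul] at hl2
        omega
    · refine h.map_ne hT hle (h.map_t hT) ?_ ?_ hv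
      · intro e
        rw [e] at hl2
        omega
      · intro e
        rw [hl2, e, mul_assoc, simple_mul_simple_self, mul_one] at hd
        omega
  · have := haw.eq_of_length_le (by omega)
    subst this
    exact hv.resolve_left (h.map_ne_self hle)

/-- The case `w = tst · w_J` of the classification: unless the matching commutes with `λ_t`, one of
the two exceptional cases occurs. -/
theorem exceptional (h : cs.IsRightSystem w J s t Mst)
    (hdl : cs.IsDoublyLaced)
    (hM : ∀ u, cs.BruhatLE u w → M u = cs.rightAction J s t Mst u)
    {y₂ z : W}
    (hF : cs.IsRightFactorization J s t w 1 (cs.simple t * cs.simple s * cs.simple t) y₂ z) :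
    (∃ L : W → W, cs.IsLeftMultMatching w L ∧ CommuteOn {u | cs.BruhatLE u w} L M ∧ L w ≠ M w) ∨
    (C s t = 4 ∧
      ((cs.parabolicMax {s, t} w = cs.simple t * cs.simple s * cs.simple t ∧
        w = cs.simple t * cs.simple s * cs.simple t * z) ∨
       (cs.parabolicMax {s, t} w = cs.simple t * cs.simple s * cs.simple t * cs.simple s ∧
        (w = cs.simple t * cs.simple s * cs.simple t * cs.simple s * z ∨
          (w = cs.simple t * cs.simple s * cs.simple t * z ∧ cs.BruhatLE (cs.simple s) z)) ∧
        M (cs.simple t * cs.simple s * cs.simple t * cs.simple s) =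
          cs.simple s * cs.simple t * cs.simple s ∧
        Mst (cs.simple t) = cs.simple t * cs.simple s ∧
        Mst (cs.simple s * cs.simple t) = cs.simple t * cs.simple s * cs.simple t ∧
        Mst (cs.simple s * cs.simple t * cs.simple s) =
          cs.simple t * cs.simple s * cs.simple t * cs.simple s))) := by
  have hinj := cs.simple_injective hdl
  have hs := h.s_mem
  have hsne : s ≠ t := fun he => h.t_notMem (he ▸ h.s_mem)
  have hst : cs.simple s ≠ cs.simple t := fun he => hsne (hinj he)
  have hmax := cs.isParabolicMax_parabolicMax hinj {s, t} w
  have hy := le_parabolicMax hinj (hF.y₁y₂_le hs) hF.y₁y₂_mem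
  have hTST := (hF.y₁_le hs).trans hy
  have hnd := hF.not_isRightDescent_y₁ hs
  have hmem := hF.y₁_mem
  set S := cs.simple s with hS
  set T := cs.simple t with hT
  have hSS : S * S = 1 := cs.simple_mul_simple_self s
  have hTT : T * T = 1 := cs.simple_mul_simple_self t
  have lS : cs.length S = 1 := cs.length_simple s
  have lT : cs.length T = 1 := cs.length_simple t
  have lST : cs.length (S * T) = 2 := cs.length_simple_mul_simple hst
  have lTS : cs.length (T * S) = 2 := cs.length_simple_mul_simple hst.symm
  have lTST : cs.length (T * S * T) = 3 := by
    rcases cs.length_mul_simple (T * S) t with h1 | h1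
    · rw [h1, lTS]
    · exfalso
      have h2 : cs.length (T * S * T) = 1 := by
        rw [← hT] at h1
        omega
      rcases cs.eq_one_or_eq_simple_of_length_le_one hinj hmem hnd h2.le with h3 | h3
      · rw [h3, length_one] at h2
        omega
      · rw [← hT, mul_eq_right] at h3
        rw [h3, length_one] at lTS
        omega
  have lTSTS : cs.length (T * S * T * S) = 4 := by
    rw [cs.not_isRightDescent_iff.1 hnd, lTST]
  have lSTS : cs.length (S * T * S) = 3 := by
    have h1 := cs.length_mul_le T (S * T * S)
    have h2 := cs.length_mul_le (S * T) S
    have h3 : T * (S * T * S) = T * S * T * S := by simp only [mul_assoc]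
    rw [h3] at h1
    omega
  -- Smaller `m` would contradict `ℓ(tst) = 3` or `ℓ(tsts) = 4`.
  have hC : C s t = 4 := by
    obtain ⟨h0, h4⟩ := hdl s t
    rcases (by omega : C s t = 1 ∨ C s t = 2 ∨ C s t = 3 ∨ C s t = 4) with h1 | h1 | h1 | h1
    · exact absurd h1 (C.off_diagonal s t hsne)
    · exfalso
      have h2 := cs.braid_of_eq_two h1
      rw [← hS, ← hT] at h2
      rw [← h2, mul_assoc, hTT, mul_one] at lTST
      omega
    · exfalso
      have h2 := cs.braid_of_eq_three h1
      rw [← hS, ← hT] at h2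
      rw [← h2, mul_assoc _ S S, hSS, mul_one] at lTSTS
      omega
    · exact h1
  have hcases : ∀ v, cs.BruhatLE v (cs.parabolicMax {s, t} w) →
      (v = 1 ∨ v = 1 * S) ∨ (v = T ∨ v = T * S) ∨ (v = S * T ∨ v = S * T * S) ∨
        (v = T * S * T ∨ v = T * S * T * S) := by
    intro v hv
    obtain ⟨a, ha, has, -, hva⟩ := h.exists_eq_mul_of_le hinj hv
    rcases cs.eq_or_of_not_isRightDescent hdl hsne ha has with rfl | rfl | rfl | rfl <;> tauto
  have hSTle : cs.BruhatLE (S * T) (T * S * T) := by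
    have h1 := cs.bruhatLE_mul_left (a := T) (b := S * T) (by rw [← mul_assoc]; omega)
    rwa [← mul_assoc] at h1
  have hST := hSTle.trans hTST
  have hTle : cs.BruhatLE T (cs.parabolicMax {s, t} w) :=
    (cs.bruhatLE_mul_left (a := S) (b := T) (by omega)).trans hST
  have hTSTle : cs.BruhatLE (T * S * T) (T * S * T * S) := cs.bruhatLE_mul_simple hnd
  have hM1 : Mst 1 = 1 * S := by rw [h.map_one, one_mul]
  have hMT : Mst T = T * S := h.map_t hTle
  have hlen : ∀ {a b : W}, cs.length a ≠ cs.length b → a ≠ b := fun h e => h (by rw [e])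
  have hne1 : ∀ {y : W}, 2 ≤ cs.length y → cs.BruhatLE y (cs.parabolicMax {s, t} w) →
      ¬ (Mst y = 1 ∨ Mst y = 1 * S) := fun hl hy => h.map_ne (cs.one_bruhatLE _) hy hM1
        (hlen (by rw [length_one]; omega)) (hlen (by rw [one_mul, ← hS]; omega))
  have hneT : ∀ {y : W}, 3 ≤ cs.length y → cs.BruhatLE y (cs.parabolicMax {s, t} w) →
      ¬ (Mst y = T ∨ Mst y = T * S) := fun hl hy => h.map_ne hTle hy hMT
        (hlen (by omega)) (hlen (by rw [← hS]; omega))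
  have hx1 : w = T * S * T * (y₂ * z) := by
    have := hF.eq
    rwa [one_mul] at this
  rcases cs.mem_parabolic_singleton.1 hF.y₂_mem with hy₂ | hy₂
  all_goals rw [hy₂] at hx1
  -- the maximum of `W_{s,t} ∩ [e, w]` is `tst` or `tsts`
  all_goals
    have hw₀ : cs.parabolicMax {s, t} w = T * S * T ∨ cs.parabolicMax {s, t} w = T * S * T * S := by
      have h1 := hTST.length_le
      rcases hcases _ (cs.bruhatLE_refl _) with (e | e) | (e | e) | (e | e) | (e | e)
      · rw [e, length_one] at h1
        omega
      · rw [e, one_mul] at h1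
        omega
      · rw [e] at h1
        omega
      · rw [e] at h1
        omega
      · rw [e] at h1
        omega
      · left
        exact (hTST.eq_of_length_le (by rw [e]; omega)).symm
      · exact Or.inl e
      · exact Or.inr e
  all_goals
    rcases hw₀ with hw₀ | hw₀
  · exact Or.inr ⟨hC, Or.inl ⟨hw₀, by rwa [one_mul] at hx1⟩⟩
  rotate_left
  -- With `y₂ = s`, the element `y₁ y₂ = tsts` cannot lie below a maximum equal to `tst`.
  · rw [hw₀, hy₂] at hy
    have := hy.length_le
    rw [← hS] at this
    omega
  all_goals
    have hSTS : cs.BruhatLE (S * T * S) (cs.parabolicMax {s, t} w) := by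
      have h1 := cs.bruhatLE_mul_left (a := T) (b := S * T * S) (by
        simp only [← mul_assoc]; omega)
      simp only [← mul_assoc] at h1
      rwa [hw₀]
    have hMST : Mst (S * T) = S * T * S ∨ Mst (S * T) = T * S * T := by
      rcases hcases _ (h.special.mapsTo _ hST) with e | e | (e | e) | (e | e)
      · exact absurd e (hne1 lST.ge hST)
      · refine absurd e (h.map_ne hTle hST hMT (hlen (by omega)) ?_)
        intro e'
        rw [← e', mul_assoc, hTT, mul_one] at lTST
        omega
      · exact absurd e (h.map_ne_self hST)
      · exact Or.inl e
      · exact Or.inr e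
      -- `st ↦ tsts` is not a Hasse edge: `tst` lies strictly between.
      · exfalso
        rcases h.special.edge _ hST with h1 | h1
        · rw [e] at h1
          rcases h1.2.2 _ hSTle hTSTle with h2 | h2
          · exact hlen (by omega) h2
          · exact hlen (by omega) h2
        · have := h1.1.length_le
          rw [e] at this
          omega
    rcases hMST with hMST | hMST
    · left
      have hMTST : Mst (T * S * T) = T * S * T * S := by
        rcases hcases _ (h.special.mapsTo _ hTST) with e | e | e | (e | e)
        · exact absurd e (hne1 (by omega) hTST)
        · exact absurd e (hneT (by omega) hTST)
        · refine absurd e (h.map_ne hST hTST hMST (hlen (by omega)) ?_)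
          intro e'
          rw [e', mul_assoc _ S S, hSS, mul_one] at lTSTS
          omega
        · exact absurd e (h.map_ne_self hTST)
        · exact e
      refine h.exists_commuting hinj hM hF (l := t) (by simp) ?_ (h.map_eq_mul hinj ?_)
      · rw [IsLeftDescent, ← hT, mul_assoc T S T, ← mul_assoc, hTT, one_mul, ← mul_assoc]
        omega
      · intro a ha has _ hle
        rcases cs.eq_or_of_not_isRightDescent hdl hsne ha has with rfl | rfl | rfl | rfl
        · exact hM1
        · exact hMT
        · exact hMST
        · exact hMTST
    · right
      have hMSTS : Mst (S * T * S) = T * S * T * S := by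
        rcases hcases _ (h.special.mapsTo _ hSTS) with e | e | (e | e) | (e | e)
        · exact absurd e (hne1 (by omega) hSTS)
        · exact absurd e (hneT (by omega) hSTS)
        · exfalso
          have h1 := h.special.involutive _ hSTS
          rw [e, hMST] at h1
          rw [h1, mul_assoc _ S S, hSS, mul_one] at lTSTS
          omega
        · exact absurd e (h.map_ne_self hSTS)
        · exfalso
          have h1 := h.special.involutive _ hSTS
          rw [e, ← hMST, h.special.involutive _ hST] at h1
          exact hlen (by omega) h1
        · exact e
      -- `tsts` has factors `y₁ = tst`, `y₂ = s` and `x = z = 1`, so `M` acts on it as `M_st`.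
      have hMM : M (T * S * T * S) = S * T * S := by
        have hle : cs.BruhatLE (T * S * T * S) w := hw₀ ▸ hmax.1.2
        have hF' : cs.IsRightFactorization J s t (T * S * T * S) 1 (T * S * T) S 1 :=
          ⟨by simp only [one_mul, mul_one], hF.x_mem, hF.y₁_mem, hF.xy₁_mem,
            cs.simple_mem_parabolic rfl, one_mem _, fun i _ => cs.not_isLeftDescent_one i⟩
        rw [hM _ hle, hF'.rightAction_eq hs, ← hMSTS, h.special.involutive _ hSTS, one_mul,
          mul_one]
      refine ⟨hC, Or.inr ⟨hw₀, ?_, hMM, hMT, hMST, hMSTS⟩⟩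
      first
        | left
          rw [← mul_assoc] at hx1
          exact hx1
        | right
          rw [one_mul] at hx1
          refine ⟨hx1, ?_⟩
          -- Without `s` below it, `z` is in `W_{J \ {s}}`, for which `tsts` is minimal; then `tsts
          -- ≤ w = tst · z` would give `tsts ≤ tst`.
          by_contra hsz
          have hzK : z ∈ cs.parabolic (J \ {s}) := by
            refine cs.parabolic_mono ?_ (cs.mem_parabolic_support z)
            intro i hi
            refine ⟨cs.mem_of_bruhatLE hinj hF.z_mem hi, ?_⟩
            rintro rfl
            exact hsz hi
          have hle : cs.BruhatLE (T * S * T * S) w := hw₀ ▸ hmax.1.2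
          have hmin : T * S * T * S ∈ cs.minCosetReps (J \ {s}) := by
            intro j hj hd
            rcases cs.mem_of_isRightDescent hinj
              (mul_mem hmem (cs.simple_mem_parabolic (by simp))) hd with rfl | h1
            · exact hj.2 rfl
            · exact h.t_notMem (Set.mem_singleton_iff.1 h1 ▸ hj.1)
          have h1 := hle.mul_of_mem_parabolic hmin (inv_mem hzK)
          rw [hx1, mul_inv_cancel_right] at h1
          have := h1.length_le
          omega

end IsRightSystem

theorem exists_commuting_leftMult_or (hdl : cs.IsDoublyLaced) {w : W} {M : W → W}
    (hMw : cs.BruhatLE (M w) w) {J : Set B} {s t : B} {Mst : W → W}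
    (h : cs.IsRightSystem w J s t Mst)
    (hM : ∀ u, cs.BruhatLE u w → M u = cs.rightAction J s t Mst u)
    (hL : ¬ cs.IsLeftMultMatching w M) :
    (∃ L : W → W, cs.IsLeftMultMatching w L ∧
      CoxeterSystem.CommuteOn {u | cs.BruhatLE u w} L M ∧ L w ≠ M w) ∨
    (C s t = 4 ∧
      ((cs.parabolicMax {s, t} w = cs.wordProd [t, s, t] ∧
        cs.minRep {s, t} (cs.minRep J w) = 1 ∧
        w = cs.wordProd [t, s, t] * cs.leftMinRep {s} (cs.parPart J w)) ∨
       (cs.parabolicMax {s, t} w = cs.wordProd [t, s, t, s] ∧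
        cs.wordProd [t, s, t, s] = cs.wordProd [s, t, s, t] ∧
        cs.minRep {s, t} (cs.minRep J w) = 1 ∧
        (w = cs.wordProd [t, s, t, s] * cs.leftMinRep {s} (cs.parPart J w) ∨
          (w = cs.wordProd [t, s, t] * cs.leftMinRep {s} (cs.parPart J w) ∧
            cs.BruhatLE (cs.simple s) (cs.leftMinRep {s} (cs.parPart J w)))) ∧
        M (cs.wordProd [t, s, t, s]) = cs.wordProd [s, t, s] ∧
        Mst 1 = cs.wordProd [s] ∧
        Mst (cs.wordProd [t]) = cs.wordProd [t, s] ∧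
        Mst (cs.wordProd [s, t]) = cs.wordProd [t, s, t] ∧
        Mst (cs.wordProd [s, t, s]) = cs.wordProd [t, s, t, s]))) := by
  have hinj := cs.simple_injective hdl
  have hs := h.s_mem
  have hsne : s ≠ t := fun he => h.t_notMem (he ▸ h.s_mem)
  have hst : cs.simple s ≠ cs.simple t := fun he => hsne (hinj he)
  have hF := cs.isRightFactorization_self hs t w
  by_cases hx : cs.minRep {s, t} (cs.minRep J w) = 1
  swap
  · left
    obtain ⟨l, hl⟩ := cs.exists_leftDescent_of_ne_one hx
    have hlw := hF.isLeftDescent hs hl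
    refine ⟨fun u => cs.simple l * u, ⟨l, hlw, fun _ _ => rfl⟩, ?_, ?_⟩
    · intro u hu
      have hlu : cs.BruhatLE (cs.simple l * u) w := hu.simple_mul_of_isLeftDescent hlw
      show cs.simple l * M u = M (cs.simple l * u)
      rw [hM u hu, hM _ hlu, h.rightAction_simple_mul hinj hl hu]
    · show cs.simple l * w ≠ M w
      rw [hM w (cs.bruhatLE_refl w), hF.rightAction_eq hs]
      have hy := IsRightSystem.le_parabolicMax hinj (hF.y₁y₂_le hs) hF.y₁y₂_mem
      have hMy := h.mem_parabolic_map hinj hy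
      have hymem := hF.y₁y₂_mem
      have heq := hF.eq
      have hxm := hF.x_mem
      generalize cs.minRep {s, t} (cs.minRep J w) = x at *
      generalize cs.leftMinRep {s} (cs.parPart J w) = z at *
      generalize cs.parPart {s, t} (cs.minRep J w) = y₁ at *
      generalize cs.leftParPart {s} (cs.parPart J w) = y₂ at *
      -- Equality would put `l x` in `x W_{s,t}`, whose minimum is `x`, although `l x` is shorter.
      intro he
      have h1 : cs.simple l * x = x * (Mst (y₁ * y₂) * (y₁ * y₂)⁻¹) := by
        rw [heq] at he
        calc cs.simple l * x = cs.simple l * (x * y₁ * (y₂ * z)) * z⁻¹ * (y₁ * y₂)⁻¹ := by group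
          _ = _ := by rw [he]; group
      have h2 := (cs.bruhatLE_refl x).mul_of_mem_parabolic hxm (mul_mem hMy (inv_mem hymem))
      rw [← h1] at h2
      have := h2.length_le
      rw [IsLeftDescent] at hl
      omega
  have hminRep := hF.minRep_eq hs
  rw [hx] at hF hminRep
  rw [one_mul] at hminRep
  have hy₁mem := hF.y₁_mem
  have hnd := hF.not_isRightDescent_y₁ hs
  have hy := IsRightSystem.le_parabolicMax hinj (hF.y₁y₂_le hs) hF.y₁y₂_mem
  have hyle := (hF.y₁_le hs).trans hy
  generalize cs.leftMinRep {s} (cs.parPart J w) = z at *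
  generalize cs.parPart {s, t} (cs.minRep J w) = y₁ at *
  generalize cs.leftParPart {s} (cs.parPart J w) = y₂ at *
  rcases cs.eq_or_of_not_isRightDescent hdl hsne hy₁mem hnd with rfl | rfl | rfl | rfl
  · exfalso
    apply hL
    -- Now `w^J = 1`, so each `u ≤ w` is `y₂ z` with `y₂ ∈ {1, s}`, where right and left
    -- multiplication by `s` agree.
    have key : ∀ u, cs.BruhatLE u w → M u = cs.simple s * u := by
      intro u hu
      have hFu := cs.isRightFactorization_self hs t u
      rw [IsRightSystem.minRep_minRep_eq_one hx hu] at hFu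
      have h1 := hu.minRep J
      rw [hminRep, hFu.minRep_eq hs, one_mul] at h1
      have h2 := h1.eq_of_length_le (by simp)
      rw [h2] at hFu
      rw [hM u hu, hFu.rightAction_eq hs, h.mul_y₂ (cs.one_bruhatLE _)
        (by rw [h.map_one, one_mul]) hFu.y₂_mem]
      generalize cs.leftParPart {s} (cs.parPart J u) = y₂ at hFu ⊢
      generalize cs.leftMinRep {s} (cs.parPart J u) = z at hFu ⊢
      rw [hFu.eq]
      rcases cs.mem_parabolic_singleton.1 hFu.y₂_mem with h3 | h3 <;> rw [h3] <;> simp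
    refine ⟨s, ?_, key⟩
    apply cs.isLeftDescent_of_bruhatLE
    rwa [← key w (cs.bruhatLE_refl w)]
  · left
    refine h.exists_commuting hinj hM hF (l := t) (by simp) (by simp [IsLeftDescent])
      (h.map_eq_mul hinj fun a ha has haw hle => ?_)
    rw [hminRep] at haw
    exact h.map_eq_mul_of_length_le_one hinj ha has hle (by simpa using haw.length_le)
  · left
    have hl2 := cs.length_simple_mul_simple hst
    refine h.exists_commuting hinj hM hF (l := s) (by simp) (by simp [IsLeftDescent, hl2])
      (h.map_eq_mul hinj fun a ha has haw hle => ?_)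
    rw [hminRep] at haw
    by_cases hal : cs.length a ≤ 1
    · exact h.map_eq_mul_of_length_le_one hinj ha has hle hal
    · rw [haw.eq_of_length_le (by omega)]
      exact h.map_simple_mul_simple hinj hminRep hyle
  · refine (h.exceptional hdl hM hF).imp id fun ⟨hC, hcase⟩ => ⟨hC, ?_⟩
    have hb := cs.braid_of_eq_four hC
    simp only [wordProd_cons, wordProd_nil, mul_one, ← mul_assoc]
    rcases hcase with ⟨h1, h2⟩ | ⟨h1, h2, h3, h4, h5, h6⟩
    · exact Or.inl ⟨h1, hx, h2⟩
    · exact Or.inr ⟨h1, hb.symm, hx, h2, h3, h.map_one, h4, h5, h6⟩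

/-! ### The symmetry `u ↦ u⁻¹` -/

/-- The map `u ↦ (M u⁻¹)⁻¹`. -/
def conjInv (M : W → W) (u : W) : W := (M u⁻¹)⁻¹

theorem minRep_inv (J : Set B) (w : W) : cs.minRep J w⁻¹ = (cs.leftMinRep J w)⁻¹ := by
  rw [leftMinRep, inv_inv]

theorem parPart_inv (J : Set B) (w : W) : cs.parPart J w⁻¹ = (cs.leftParPart J w)⁻¹ := by
  rw [leftParPart, inv_inv]

theorem leftMinRep_inv (J : Set B) (w : W) : cs.leftMinRep J w⁻¹ = (cs.minRep J w)⁻¹ := by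
  rw [leftMinRep, inv_inv]

theorem leftParPart_inv (J : Set B) (w : W) : cs.leftParPart J w⁻¹ = (cs.parPart J w)⁻¹ := by
  rw [leftParPart, inv_inv]

/-- The maximum is a choice by `epsilon`, so its compatibility with inversion comes from uniqueness.
-/
theorem parabolicMax_inv (hinj : Function.Injective cs.simple) (J : Set B) (w : W) :
    cs.parabolicMax J w⁻¹ = (cs.parabolicMax J w)⁻¹ := by
  obtain ⟨⟨h1, h2⟩, h3⟩ := cs.isParabolicMax_parabolicMax hinj J w
  refine (cs.isParabolicMax_parabolicMax hinj J w⁻¹).eq ⟨⟨inv_mem h1, h2.inv⟩, fun y hy hyw => ?_⟩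
  rw [← cs.bruhatLE_inv_comm] at hyw ⊢
  exact h3 _ (inv_mem hy) hyw

theorem rightAction_conjInv (J : Set B) (s t : B) (Mst : W → W) (u : W) :
    cs.rightAction J s t (conjInv Mst) u = (cs.leftAction J s t Mst u⁻¹)⁻¹ := by
  simp only [rightAction, leftAction, conjInv, leftParPart_inv, leftMinRep_inv, minRep_inv,
    parPart_inv, mul_inv_rev, inv_inv, mul_assoc]

variable {cs} in
theorem BruhatCovBy.inv {u v : W} (h : cs.BruhatCovBy u v) : cs.BruhatCovBy u⁻¹ v⁻¹ := by
  refine ⟨h.1.inv, fun e => h.2.1 (inv_injective e), fun z hz hz' => ?_⟩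
  rw [cs.bruhatLE_inv_comm] at hz
  rw [← cs.bruhatLE_inv_comm] at hz'
  rcases h.2.2 z⁻¹ hz hz' with e | e
  · exact Or.inl (by rw [← e, inv_inv])
  · exact Or.inr (by rw [← e, inv_inv])

variable {cs} in
theorem IsSpecialMatching.conjInv {w : W} {M : W → W} (h : cs.IsSpecialMatching w M) :
    cs.IsSpecialMatching w⁻¹ (conjInv M) where
  mapsTo u hu := (h.mapsTo _ (cs.bruhatLE_inv_comm.2 hu)).inv
  involutive u hu := by
    rw [CoxeterSystem.conjInv, CoxeterSystem.conjInv, inv_inv,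
      h.involutive _ (cs.bruhatLE_inv_comm.2 hu), inv_inv]
  edge u hu := by
    refine (h.edge _ (cs.bruhatLE_inv_comm.2 hu)).imp (fun h => ?_) (fun h => ?_)
    · simpa [CoxeterSystem.conjInv] using h.inv
    · simpa [CoxeterSystem.conjInv] using h.inv
  special u v hu hv huv hne :=
    (h.special _ _ (cs.bruhatLE_inv_comm.2 hu) (cs.bruhatLE_inv_comm.2 hv) huv.inv
      fun e => hne (by rw [CoxeterSystem.conjInv, e, inv_inv])).inv

theorem simple_bruhatLE_inv_iff {i : B} {u : W} :
    cs.BruhatLE (cs.simple i) u⁻¹ ↔ cs.BruhatLE (cs.simple i) u := by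
  rw [← cs.bruhatLE_inv_comm, inv_simple]

variable {cs} in
theorem IsLeftSystem.conjInv (hinj : Function.Injective cs.simple) {w : W} {J : Set B} {s t : B}
    {Mst : W → W} (h : cs.IsLeftSystem w J s t Mst) :
    cs.IsRightSystem w⁻¹ J s t (conjInv Mst) where
  s_mem := h.s_mem
  t_notMem := h.t_notMem
  special := by
    rw [parabolicMax_inv cs hinj]
    exact h.special.conjInv
  map_one := by rw [CoxeterSystem.conjInv, inv_one, h.map_one, inv_simple]
  map_t hle := by
    rw [parabolicMax_inv cs hinj, simple_bruhatLE_inv_iff] at hle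
    rw [CoxeterSystem.conjInv, inv_simple, h.map_t hle, mul_inv_rev, inv_simple, inv_simple]
  action_le u hu := by
    rw [rightAction_conjInv]
    exact (h.action_le _ (cs.bruhatLE_inv_comm.2 hu)).inv
  comm_s r hr hle := by
    rw [minRep_inv, simple_bruhatLE_inv_iff] at hle
    exact h.comm_s r hr hle
  both_le hs ht u hu := by
    rw [minRep_inv, minRep_inv, simple_bruhatLE_inv_iff] at hs ht
    rw [parabolicMax_inv cs hinj, ← cs.bruhatLE_inv_comm] at hu
    rw [CoxeterSystem.conjInv, h.both_le hs ht _ hu, mul_inv_rev, inv_simple, inv_inv]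
  s_le hs ht u hu := by
    rw [minRep_inv, minRep_inv, simple_bruhatLE_inv_iff] at hs ht
    rw [Set.mem_ofPred_eq, parabolicMax_inv cs hinj, ← cs.bruhatLE_inv_comm] at hu
    have := congrArg (·⁻¹) (h.s_le hs ht _ hu)
    simpa [CoxeterSystem.conjInv] using this
  t_le hs ht u hu := by
    rw [minRep_inv, minRep_inv, simple_bruhatLE_inv_iff] at hs ht
    rw [Set.mem_ofPred_eq, parabolicMax_inv cs hinj, ← cs.bruhatLE_inv_comm] at hu
    have := congrArg (·⁻¹) (h.t_le hs ht _ hu)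
    simpa [CoxeterSystem.conjInv] using this
  comm_mul v hv hs u hu := by
    rw [← cs.bruhatLE_inv_comm] at hv
    rw [Set.mem_ofPred_eq, parabolicMax_inv cs hinj, ← cs.bruhatLE_inv_comm] at hu
    have hs' : cs.BruhatLE (cs.simple s) (cs.minRep {s} (cs.leftParPart J v⁻¹)) := by
      rwa [leftParPart_inv, minRep_inv, simple_bruhatLE_inv_iff]
    have := congrArg (·⁻¹) (h.comm_mul _ hv hs' u⁻¹ ⟨hu.1.inv, hu.2⟩)
    simpa [CoxeterSystem.conjInv] using this

theorem exists_commuting_rightMult_or (hdl : cs.IsDoublyLaced) {w : W} {M : W → W}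
    (hMw : cs.BruhatLE (M w) w) {J : Set B} {s t : B} {Mst : W → W}
    (h : cs.IsLeftSystem w J s t Mst)
    (hM : ∀ u, cs.BruhatLE u w → M u = cs.leftAction J s t Mst u)
    (hR : ¬ cs.IsRightMultMatching w M) :
    (∃ R : W → W, cs.IsRightMultMatching w R ∧
      CoxeterSystem.CommuteOn {u | cs.BruhatLE u w} R M ∧ R w ≠ M w) ∨
    (C s t = 4 ∧
      ((cs.parabolicMax {s, t} w = cs.wordProd [t, s, t] ∧
        cs.leftMinRep {s, t} (cs.leftMinRep J w) = 1 ∧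
        w = cs.minRep {s} (cs.leftParPart J w) * cs.wordProd [t, s, t]) ∨
       (cs.parabolicMax {s, t} w = cs.wordProd [s, t, s, t] ∧
        cs.wordProd [s, t, s, t] = cs.wordProd [t, s, t, s] ∧
        cs.leftMinRep {s, t} (cs.leftMinRep J w) = 1 ∧
        (w = cs.minRep {s} (cs.leftParPart J w) * cs.wordProd [s, t, s, t] ∨
          (w = cs.minRep {s} (cs.leftParPart J w) * cs.wordProd [t, s, t] ∧
            cs.BruhatLE (cs.simple s) (cs.minRep {s} (cs.leftParPart J w)))) ∧
        M (cs.wordProd [s, t, s, t]) = cs.wordProd [s, t, s] ∧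
        Mst 1 = cs.wordProd [s] ∧
        Mst (cs.wordProd [t]) = cs.wordProd [s, t] ∧
        Mst (cs.wordProd [t, s]) = cs.wordProd [t, s, t] ∧
        Mst (cs.wordProd [s, t, s]) = cs.wordProd [s, t, s, t]))) := by
  have hinj := cs.simple_injective hdl
  have key := cs.exists_commuting_leftMult_or hdl (w := w⁻¹) (M := conjInv M)
    (by rw [conjInv, inv_inv]; exact hMw.inv) (h.conjInv hinj)
    (fun u hu => by
      rw [rightAction_conjInv, conjInv, hM _ (cs.bruhatLE_inv_comm.2 hu)])
    (by
      rintro ⟨i, hi, hi'⟩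
      refine hR ⟨i, (cs.isLeftDescent_inv_iff).1 hi, fun u hu => ?_⟩
      have := congrArg (·⁻¹) (hi' u⁻¹ hu.inv)
      simpa [conjInv] using this)
  -- Inversion reverses words; these identities carry the exceptional cases for `w⁻¹` over to their
  -- mirror images.
  have hinv : ∀ ω : List B, cs.wordProd ω = (cs.wordProd ω.reverse)⁻¹ := by simp
  have hst := hinv [s, t]
  have hts := hinv [t, s]
  have hsts := hinv [s, t, s]
  have htst := hinv [t, s, t]
  have hstst := hinv [s, t, s, t]
  have htsts := hinv [t, s, t, s]
  have hs1 := hinv [s]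
  have ht1 := hinv [t]
  simp only [List.reverse_cons, List.reverse_nil, List.nil_append, List.cons_append] at *
  rw [parabolicMax_inv cs hinj, minRep_inv, minRep_inv, parPart_inv, leftMinRep_inv,
    simple_bruhatLE_inv_iff] at key
  refine key.imp ?_ (And.imp_right (Or.imp ?_ ?_))
  · rintro ⟨L, ⟨i, hi, hi'⟩, hc, hne⟩
    refine ⟨conjInv L, ⟨i, (cs.isLeftDescent_inv_iff).1 hi, fun u hu => ?_⟩, fun u hu => ?_, ?_⟩
    · rw [conjInv, hi' _ hu.inv, mul_inv_rev, inv_simple, inv_inv]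
    · have := congrArg (·⁻¹) (hc u⁻¹ hu.inv)
      simpa [conjInv] using this
    · intro e
      apply hne
      rw [conjInv, inv_eq_iff_eq_inv] at e
      rw [e, conjInv, inv_inv]
  · rintro ⟨h1, h2, h3⟩
    refine ⟨?_, inv_eq_one.1 h2, ?_⟩
    · rw [htst, ← h1, inv_inv]
    · rw [htst, ← inv_inj, h3]
      simp
  · rintro ⟨h1, h2, h3, h4, h5, h6, h7, h8, h9⟩
    refine ⟨?_, ?_, inv_eq_one.1 h3, ?_, ?_, ?_, ?_, ?_, ?_⟩
    · rw [hstst, ← h1, inv_inv]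
    · exact h2.symm
    · refine h4.imp (fun h => ?_) (fun h => ⟨?_, h.2⟩)
      · rw [hstst, ← inv_inj, h]
        simp
      · rw [htst, ← inv_inj, h.1]
        simp
    · rw [hstst, ← inv_inj, ← hsts]
      exact h5
    · simpa [conjInv, inv_eq_iff_eq_inv] using h6
    · rw [ht1, hst, ← inv_inj, inv_inv]
      exact h7
    · rw [hts, htst, ← inv_inj, inv_inv]
      exact h8
    · rw [hstst, hsts, ← inv_inj, inv_inv]
      exact h9

end CoxeterSystem

theorem mainTheorem6 {B W : Type*} [Group W] {C : CoxeterMatrix B} (cs : CoxeterSystem C W)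
    (hdl : cs.IsDoublyLaced) (w : W) (M : W → W) (hM : cs.IsSpecialMatching w M)
    (J : Set B) (s t : B) (Mst : W → W) :
    (cs.IsRightSystem w J s t Mst →
      (∀ u, cs.BruhatLE u w → M u = cs.rightAction J s t Mst u) →
      ¬ cs.IsLeftMultMatching w M →
      (∃ L : W → W, cs.IsLeftMultMatching w L ∧
        CoxeterSystem.CommuteOn {u | cs.BruhatLE u w} L M ∧ L w ≠ M w) ∨
      (C s t = 4 ∧
        ((cs.parabolicMax {s, t} w = cs.wordProd [t, s, t] ∧
          cs.minRep {s, t} (cs.minRep J w) = 1 ∧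
          w = cs.wordProd [t, s, t] * cs.leftMinRep {s} (cs.parPart J w)) ∨
         (cs.parabolicMax {s, t} w = cs.wordProd [t, s, t, s] ∧
          cs.wordProd [t, s, t, s] = cs.wordProd [s, t, s, t] ∧
          cs.minRep {s, t} (cs.minRep J w) = 1 ∧
          (w = cs.wordProd [t, s, t, s] * cs.leftMinRep {s} (cs.parPart J w) ∨
            (w = cs.wordProd [t, s, t] * cs.leftMinRep {s} (cs.parPart J w) ∧
              cs.BruhatLE (cs.simple s) (cs.leftMinRep {s} (cs.parPart J w)))) ∧
          M (cs.wordProd [t, s, t, s]) = cs.wordProd [s, t, s] ∧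
          Mst 1 = cs.wordProd [s] ∧
          Mst (cs.wordProd [t]) = cs.wordProd [t, s] ∧
          Mst (cs.wordProd [s, t]) = cs.wordProd [t, s, t] ∧
          Mst (cs.wordProd [s, t, s]) = cs.wordProd [t, s, t, s])))) ∧
    (cs.IsLeftSystem w J s t Mst →
      (∀ u, cs.BruhatLE u w → M u = cs.leftAction J s t Mst u) →
      ¬ cs.IsRightMultMatching w M →
      (∃ R : W → W, cs.IsRightMultMatching w R ∧
        CoxeterSystem.CommuteOn {u | cs.BruhatLE u w} R M ∧ R w ≠ M w) ∨
      (C s t = 4 ∧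
        ((cs.parabolicMax {s, t} w = cs.wordProd [t, s, t] ∧
          cs.leftMinRep {s, t} (cs.leftMinRep J w) = 1 ∧
          w = cs.minRep {s} (cs.leftParPart J w) * cs.wordProd [t, s, t]) ∨
         (cs.parabolicMax {s, t} w = cs.wordProd [s, t, s, t] ∧
          cs.wordProd [s, t, s, t] = cs.wordProd [t, s, t, s] ∧
          cs.leftMinRep {s, t} (cs.leftMinRep J w) = 1 ∧
          (w = cs.minRep {s} (cs.leftParPart J w) * cs.wordProd [s, t, s, t] ∨
            (w = cs.minRep {s} (cs.leftParPart J w) * cs.wordProd [t, s, t] ∧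
              cs.BruhatLE (cs.simple s) (cs.minRep {s} (cs.leftParPart J w)))) ∧
          M (cs.wordProd [s, t, s, t]) = cs.wordProd [s, t, s] ∧
          Mst 1 = cs.wordProd [s] ∧
          Mst (cs.wordProd [t]) = cs.wordProd [s, t] ∧
          Mst (cs.wordProd [t, s]) = cs.wordProd [t, s, t] ∧
          Mst (cs.wordProd [s, t, s]) = cs.wordProd [s, t, s, t])))) :=
  ⟨fun h hM' hL => cs.exists_commuting_leftMult_or hdl (hM.mapsTo w (cs.bruhatLE_refl w)) h hM' hL,
    fun h hM' hR => cs.exists_commuting_rightMult_or hdl (hM.mapsTo w (cs.bruhatLE_refl w)) h hM' hR⟩
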